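/- Boolean functions are the maps $f\colon\{0,1\}^n\to\{0,1\}$ with $n\ge 1$; $\Omega$ is the class of all of them. For classes $I,J\subseteq\Omega$ let $$IJ=\{\,f(g_1,\dots,g_n) : n,m\ge 1,\ f\in I\text{ is } n\text{-ary},\ g_1,\dots,g_n\in J\text{ are } m\text{-ary}\,\}.$$ A *clone* is a class $C\subseteq\Omega$ that contains the class $I_c$ of all projections and satisfies $CC\subseteq C$. For clones $C_1,C_2$, a class $F\subseteq\Omega$ is *$(C_1,C_2)$-stable* if $FC_1\subseteq F$ and $C_2F\subseteq F$, and *$C$-stable* if it is $(C,C)$-stable. Write $\mathbf 0=(0,\dots,0)$, $\mathbf 1=(1,\dots,1)$, and $\overline{\mathbf a}$ for the componentwise complement of $\mathbf a$. For $K\subseteq\Omega$ and $a,b\in\{0,1\}$ let $K_{a*}=\{f\in K: f(\mathbf 0)=a\}$, $K_{*b}=\{f\in K: f(\mathbf 1)=b\}$, $K_{ab}=K_{a*}\cap K_{*b}$; for ${\sim}\in\{=,\ne,\le,\ge\}$ let $K_{\sim}=\{f\in K: f(\mathbf 0)\sim f(\mathbf 1)\}$; let $K_{\ne,00}=K_{\ne}\cup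 K_{00}$, $K_{\ne,11}=K_{\ne}\cup K_{11}$, and $\overline K=\{1-f: f\in K\}$. Furthermore let - $\mathsf C$ be the class of constant functions, $\mathsf C_0$ and $\mathsf C_1$ the classes of those equal to $0$ and to $1$; - $M$ be the class of monotone functions; - $S$ be the class of self-dual functions ($f(\mathbf a)=1-f(\overline{\mathbf a})$ for all $\mathbf a$) and $R$ the class of reflexive functions ($f(\mathbf a)=f(\overline{\mathbf a})$ for all $\mathbf a$); - $S^-$ be the class of functions $f\le g$ for some $g\in S$, and $S^+$ the class of functions $f\ge g$ for some $g\in S$ ($g$ of the same arity as $f$); - $U$ be the class of functions such that $\mathbf a\wedge\mathbf b\ne\mathbf 0$ whenever $f(\mathbf a)=f(\mathbf b)=1$, and $W$ the class of functions such that $\mathbf a\vee\mathbf b\ne\mathbf 1$ whenever $f(\mathbf a)=f(\mathbf b)=0$. **Theorem.** There are exactly the following 19 clones $C$ with $S\cap M\subseteq C$: $S\cap M$, $M_{01}\cap U$, $M\cap U$, $U_{01}$, $U$, $M_{01}\cap W$, $M\cap W$, $W_{01}$, $W$, $S_{01}$, $S$, $M_{01}$, $M_{0*}$, $M_{*1}$,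 $M$, $\Omega_{01}$, $\Omega_{0*}$, $\Omega_{*1}$, $\Omega$. The $C$-stable classes for these clones are as follows. (a) The $(S\cap M)$-stable classes are precisely the $(I_c,S\cap M)$-stable classes; there are exactly 93 of them, namely $\Omega$, $\Omega_{\le}$, $\Omega_{\ge}$, $\Omega_{\ne,00}$, $\Omega_{\ne,11}$, $\Omega_{0*}\cup \mathsf C$, $\Omega_{*0}\cup \mathsf C$, $\Omega_{00}\cup \mathsf C$, $\Omega_{01}\cup \mathsf C$, $\Omega_{01}\cup \mathsf C_0$, $\Omega_{01}\cup \mathsf C_1$, $\Omega_{1*}\cup \mathsf C$, $\Omega_{*1}\cup \mathsf C$, $\Omega_{11}\cup \mathsf C$, $\Omega_{10}\cup \mathsf C$, $\Omega_{10}\cup \mathsf C_1$, $\Omega_{10}\cup \mathsf C_0$, $\Omega_{\ne}$, $\Omega_{=}$, $\Omega_{0*}$, $\Omega_{1*}$, $\Omega_{*0}$, $\Omega_{*1}$, $\Omega_{00}$, $\Omega_{11}$, $\Omega_{01}$, $\Omega_{10}$, $M$, $M_{0*}$, $M_{*1}$, $M_{01}$, $\overline{M}$, $\overline{M_{0*}}$,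 $\overline{M_{*1}}$, $\overline{M_{01}}$, $S^-$, $S^-_{\ne}$, $S^-_{0*}$, $S^-_{*0}$, $S^-_{01}\cup\mathsf C_0$, $S^-_{10}\cup\mathsf C_0$, $S^-_{01}$, $S^-_{10}$, $S^-_{00}$, $S^+$, $S^+_{\ne}$, $S^+_{1*}$, $S^+_{*1}$, $S^+_{10}\cup\mathsf C_1$, $S^+_{01}\cup\mathsf C_1$, $S^+_{10}$, $S^+_{01}$, $S^+_{11}$, $S$, $S_{01}$, $\overline{S_{01}}$, $S\cap M$, $\overline{S\cap M}$, $U$, $U_{01}\cup\mathsf C_0$, $U_{01}$, $M\cap U$, $M_{01}\cap U$, $U_{00}$, $\overline{U}$, $\overline{U_{01}}\cup\mathsf C_1$, $\overline{U_{01}}$, $\overline{M\cap U}$, $\overline{M_{01}\cap U}$, $\overline{U}_{11}$, $W$, $W_{01}\cup\mathsf C_1$, $W_{01}$, $M\cap W$, $M_{01}\cap W$, $W_{11}$, $\overline{W}$, $\overline{W_{01}}\cup\mathsf C_0$, $\overline{W_{01}}$, $\overline{M\cap W}$, $\overline{M_{01}\cap W}$, $\overline{W}_{00}$, $U\cap\overline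 W$, $W\cap\overline U$, $R$, $R_{00}\cup\mathsf C$, $R_{11}\cup\mathsf C$, $R_{00}$, $R_{11}$, $\mathsf C$, $\mathsf C_0$, $\mathsf C_1$, $\emptyset$. (b) The $M_{01}\cap U$-stable classes are $\Omega$, $\Omega_{\le}$, $\Omega_{\ge}$, $\Omega_{\ne,00}$, $\Omega_{=}$, $\Omega_{0*}\cup \mathsf C$, $\Omega_{1*}\cup \mathsf C$, $\Omega_{*0}\cup \mathsf C$, $\Omega_{*1}\cup \mathsf C$, $\Omega_{0*}$, $\Omega_{1*}$, $\Omega_{*0}$, $\Omega_{*1}$, $\Omega_{00}\cup \mathsf C$, $\Omega_{11}\cup \mathsf C$, $\Omega_{00}$, $\Omega_{11}$, $\Omega_{01}\cup \mathsf C$, $\Omega_{10}\cup \mathsf C$, $\Omega_{01}\cup \mathsf C_0$, $\Omega_{10}\cup \mathsf C_1$, $\Omega_{01}\cup \mathsf C_1$, $\Omega_{10}\cup \mathsf C_0$, $\Omega_{01}$, $\Omega_{10}$, $M$, $\overline{M}$, $M_{0*}$, $\overline{M_{0*}}$, $M_{*1}$, $\overline{M_{*1}}$, $M_{01}$, $\overline{M_{01}}$,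 $U$, $U_{01}\cup\mathsf C_0$, $U_{01}$, $M\cap U$, $M_{01}\cap U$, $U_{00}$, $\mathsf C$, $\mathsf C_0$, $\mathsf C_1$, $\emptyset$. (c) The $M\cap U$-stable classes are $\Omega$, $\Omega_{0*}\cup \mathsf C$, $\Omega_{1*}\cup \mathsf C$, $\Omega_{0*}$, $M$, $\overline{M}$, $M_{0*}$, $U$, $M\cap U$, $\mathsf C$, $\mathsf C_0$, $\emptyset$. (d) The $U_{01}$-stable classes are $\Omega$, $\Omega_{\ne,00}$, $\Omega_{=}$, $\Omega_{0*}$, $\Omega_{1*}$, $\Omega_{*0}$, $\Omega_{*1}$, $\Omega_{00}$, $\Omega_{11}$, $\Omega_{01}$, $\Omega_{10}$, $U$, $U_{01}$, $U_{00}$, $\mathsf C$, $\mathsf C_0$, $\mathsf C_1$, $\emptyset$. (e) The $U$-stable classes are $\Omega$, $\Omega_{0*}$, $U$, $\mathsf C$, $\mathsf C_0$, $\emptyset$. (f) The $M_{01}\cap W$-stable classes are $\Omega$, $\Omega_{\le}$, $\Omega_{\ge}$, $\Omega_{\ne,11}$, $\Omega_{=}$, $\Omega_{0*}\cup \mathsf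 C$, $\Omega_{1*}\cup \mathsf C$, $\Omega_{*0}\cup \mathsf C$, $\Omega_{*1}\cup \mathsf C$, $\Omega_{0*}$, $\Omega_{1*}$, $\Omega_{*0}$, $\Omega_{*1}$, $\Omega_{00}\cup \mathsf C$, $\Omega_{11}\cup \mathsf C$, $\Omega_{00}$, $\Omega_{11}$, $\Omega_{01}\cup \mathsf C$, $\Omega_{10}\cup \mathsf C$, $\Omega_{01}\cup \mathsf C_0$, $\Omega_{10}\cup \mathsf C_1$, $\Omega_{01}\cup \mathsf C_1$, $\Omega_{10}\cup \mathsf C_0$, $\Omega_{01}$, $\Omega_{10}$, $M$, $\overline{M}$, $M_{0*}$, $\overline{M_{0*}}$, $M_{*1}$, $\overline{M_{*1}}$, $M_{01}$, $\overline{M_{01}}$, $W$, $W_{01}\cup\mathsf C_1$, $W_{01}$, $M\cap W$, $M_{01}\cap W$, $W_{11}$, $\mathsf C$, $\mathsf C_0$, $\mathsf C_1$, $\emptyset$. (g) The $M\cap W$-stable classes are $\Omega$, $\Omega_{*0}\cup \mathsf C$, $\Omega_{*1}\cup \mathsf C$, $\Omega_{*1}$, $M$, $\overline{M}$, $M_{*1}$,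 $W$, $M\cap W$, $\mathsf C$, $\mathsf C_1$, $\emptyset$. (h) The $W_{01}$-stable classes are $\Omega$, $\Omega_{\ne,11}$, $\Omega_{=}$, $\Omega_{0*}$, $\Omega_{1*}$, $\Omega_{*0}$, $\Omega_{*1}$, $\Omega_{00}$, $\Omega_{11}$, $\Omega_{01}$, $\Omega_{10}$, $W$, $W_{01}$, $W_{11}$, $\mathsf C$, $\mathsf C_0$, $\mathsf C_1$, $\emptyset$. (i) The $W$-stable classes are $\Omega$, $\Omega_{*1}$, $W$, $\mathsf C$, $\mathsf C_1$, $\emptyset$. (j) The $S_{01}$-stable classes are $\Omega$, $\Omega_{=}$, $\Omega_{\ne}$, $\Omega_{0*}$, $\Omega_{1*}$, $\Omega_{*0}$, $\Omega_{*1}$, $\Omega_{00}$, $\Omega_{11}$, $\Omega_{01}$, $\Omega_{10}$, $S$, $S_{01}$, $\overline{S_{01}}$, $R$, $R_{00}$, $R_{11}$, $\mathsf C$, $\mathsf C_0$, $\mathsf C_1$, $\emptyset$. (k) The $S$-stable classes are $\Omega$, $S$, $R$, $\mathsf C$, $\emptyset$. (l) The $M_{01}$-stable classes are $\Omega$, $\Omega_{\ge}$,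 $\Omega_{\le}$, $\Omega_{=}$, $\Omega_{0*}\cup \mathsf C$, $\Omega_{1*}\cup \mathsf C$, $\Omega_{*0}\cup \mathsf C$, $\Omega_{*1}\cup \mathsf C$, $\Omega_{0*}$, $\Omega_{1*}$, $\Omega_{*0}$, $\Omega_{*1}$, $\Omega_{00}\cup \mathsf C$, $\Omega_{11}\cup \mathsf C$, $\Omega_{00}$, $\Omega_{11}$, $\Omega_{01}\cup \mathsf C$, $\Omega_{10}\cup \mathsf C$, $\Omega_{01}\cup \mathsf C_0$, $\Omega_{10}\cup \mathsf C_1$, $\Omega_{01}\cup \mathsf C_1$, $\Omega_{10}\cup \mathsf C_0$, $\Omega_{01}$, $\Omega_{10}$, $M$, $\overline{M}$, $M_{0*}$, $\overline{M_{0*}}$, $M_{*1}$, $\overline{M_{*1}}$, $M_{01}$, $\overline{M_{01}}$, $\mathsf C$, $\mathsf C_0$, $\mathsf C_1$, $\emptyset$. (m) The $M_{0*}$-stable classes are $\Omega$, $\Omega_{0*}\cup \mathsf C$, $\Omega_{1*}\cup \mathsf C$, $\Omega_{0*}$, $M$, $\overline{M}$, $M_{0*}$, $\mathsf C$, $\mathsf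 C_0$, $\emptyset$. (n) The $M_{*1}$-stable classes are $\Omega$, $\Omega_{*0}\cup \mathsf C$, $\Omega_{*1}\cup \mathsf C$, $\Omega_{*1}$, $M$, $\overline{M}$, $M_{*1}$, $\mathsf C$, $\mathsf C_1$, $\emptyset$. (o) The $M$-stable classes are $\Omega$, $M$, $\overline{M}$, $\mathsf C$, $\emptyset$. (p) The $\Omega_{01}$-stable classes are $\Omega$, $\Omega_{=}$, $\Omega_{0*}$, $\Omega_{1*}$, $\Omega_{*0}$, $\Omega_{*1}$, $\Omega_{00}$, $\Omega_{11}$, $\Omega_{01}$, $\Omega_{10}$, $\mathsf C$, $\mathsf C_0$, $\mathsf C_1$, $\emptyset$. (q) The $\Omega_{0*}$-stable classes are $\Omega$, $\Omega_{0*}$, $\mathsf C$, $\mathsf C_0$, $\emptyset$. (r) The $\Omega_{*1}$-stable classes are $\Omega$, $\Omega_{*1}$, $\mathsf C$, $\mathsf C_1$, $\emptyset$. (s) The $\Omega$-stable classes are $\Omega$, $\mathsf C$, $\emptyset$. -/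

import Mathlib

namespace BoolClass

/-! Functions of several arguments, composition of function classes, clones, stability. -/

/-- Functions of several arguments from `A` to `B`: a positive arity `n` and a map `Aⁿ → B`. -/
abbrev Fn (A B : Type*) := Σ n : ℕ+, (Fin n → A) → B

/-- The composition `IJ` of function classes: all `f(g₁, …, gₙ)` with `f ∈ I` of arity `n` and
`g₁, …, gₙ ∈ J` of a common arity `m`. -/
def comp {A B C : Type*} (I : Set (Fn B C)) (J : Set (Fn A B)) : Set (Fn A C) :=
  {h | ∃ (n m : ℕ+) (f : (Fin n → B) → C) (g : Fin n → (Fin m → A) → B),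
    (⟨n, f⟩ : Fn B C) ∈ I ∧ (∀ i, (⟨m, g i⟩ : Fn A B) ∈ J) ∧
      h = ⟨m, fun a => f fun i => g i a⟩}

/-- The projections on `A`. -/
def projections (A : Type*) : Set (Fn A A) :=
  {p | ∃ i : Fin p.1, ∀ a, p.2 a = a i}

/-- A clone on `A`: contains the projections and is closed under composition. -/
def IsClone {A : Type*} (C : Set (Fn A A)) : Prop :=
  projections A ⊆ C ∧ comp C C ⊆ C

/-- `F` is `(C₁, C₂)`-stable: stable under right composition with `C₁` and under left composition
with `C₂`. -/
def IsStable {A B : Type*} (C₁ : Set (Fn A A)) (C₂ : Set (Fn B B)) (F : Set (Fn A B)) : Prop :=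
  comp F C₁ ⊆ F ∧ comp C₂ F ⊆ F

/-- The set of all `(C₁, C₂)`-stable classes. -/
def stableClasses {A B : Type*} (C₁ : Set (Fn A A)) (C₂ : Set (Fn B B)) : Set (Set (Fn A B)) :=
  {F | IsStable C₁ C₂ F}

/-! Boolean functions: `Bool` with `false < true` stands for `{0, 1}`; the tuples `0…0` and `1…1`
are `⊥` and `⊤`, and `aᶜ` is the componentwise complement. -/

/-- Members of `K` with `f(0…0) = a`. -/
def valZero (K : Set (Fn Bool Bool)) (a : Bool) : Set (Fn Bool Bool) := {f ∈ K | f.2 ⊥ = a}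

/-- Members of `K` with `f(1…1) = b`. -/
def valOne (K : Set (Fn Bool Bool)) (b : Bool) : Set (Fn Bool Bool) := {f ∈ K | f.2 ⊤ = b}

/-- Members of `K` with `f(0…0) = a` and `f(1…1) = b`. -/
def val (K : Set (Fn Bool Bool)) (a b : Bool) : Set (Fn Bool Bool) := valZero K a ∩ valOne K b

def eqPart (K : Set (Fn Bool Bool)) : Set (Fn Bool Bool) := {f ∈ K | f.2 ⊥ = f.2 ⊤}

def neqPart (K : Set (Fn Bool Bool)) : Set (Fn Bool Bool) := {f ∈ K | f.2 ⊥ ≠ f.2 ⊤}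

def leqPart (K : Set (Fn Bool Bool)) : Set (Fn Bool Bool) := {f ∈ K | f.2 ⊥ ≤ f.2 ⊤}

def geqPart (K : Set (Fn Bool Bool)) : Set (Fn Bool Bool) := {f ∈ K | f.2 ⊥ ≥ f.2 ⊤}

def neq00Part (K : Set (Fn Bool Bool)) : Set (Fn Bool Bool) := neqPart K ∪ val K false false

def neq11Part (K : Set (Fn Bool Bool)) : Set (Fn Bool Bool) := neqPart K ∪ val K true true

/-- The class of the negations `a ↦ ¬ f(a)` of the members of `K`. -/
def negClass (K : Set (Fn Bool Bool)) : Set (Fn Bool Bool) :=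
  (fun f : Fn Bool Bool => (⟨f.1, fun a => (f.2 a)ᶜ⟩ : Fn Bool Bool)) '' K

/-- All Boolean functions. -/
def clAll : Set (Fn Bool Bool) := Set.univ

/-- The projections. -/
def clIc : Set (Fn Bool Bool) := projections Bool

/-- The constant functions. -/
def clC : Set (Fn Bool Bool) := {f | ∃ c, ∀ a, f.2 a = c}

/-- The monotone functions. -/
def clM : Set (Fn Bool Bool) := {f | ∀ a b, a ≤ b → f.2 a ≤ f.2 b}

/-- The self-dual functions. -/
def clS : Set (Fn Bool Bool) := {f | ∀ a, f.2 a = (f.2 aᶜ)ᶜ}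

/-- The reflexive functions. -/
def clR : Set (Fn Bool Bool) := {f | ∀ a, f.2 a = f.2 aᶜ}

/-- The minorants of self-dual functions. -/
def clSmin : Set (Fn Bool Bool) :=
  {f | ∃ g : (Fin f.1 → Bool) → Bool, (⟨f.1, g⟩ : Fn Bool Bool) ∈ clS ∧ ∀ a, f.2 a ≤ g a}

/-- The majorants of self-dual functions. -/
def clSmaj : Set (Fn Bool Bool) :=
  {f | ∃ g : (Fin f.1 → Bool) → Bool, (⟨f.1, g⟩ : Fn Bool Bool) ∈ clS ∧ ∀ a, g a ≤ f.2 a}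

/-- The `1`-separating functions of rank `k`. -/
def oneSeparating (k : ℕ) : Set (Fn Bool Bool) :=
  {f | ∀ a : Fin k → Fin f.1 → Bool, (∀ i, f.2 (a i) = true) → Finset.univ.inf a ≠ ⊥}

/-- The `0`-separating functions of rank `k`. -/
def zeroSeparating (k : ℕ) : Set (Fn Bool Bool) :=
  {f | ∀ a : Fin k → Fin f.1 → Bool, (∀ i, f.2 (a i) = false) → Finset.univ.sup a ≠ ⊤}

/-- The `1`-separating functions of rank `2`. -/
def clU : Set (Fn Bool Bool) := oneSeparating 2

/-- The `0`-separating functions of rank `2`. -/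
def clW : Set (Fn Bool Bool) := zeroSeparating 2

/-! The remaining classes. Name scheme: the suffixes `0X`, `X0`, `01`, … prescribe the values at
`0…0` and `1…1` (`X` is no condition), `C`, `C0`, `C1` after such a suffix is the union with all
constants, the constants equal to `0`, the constants equal to `1`; `neg` is the negated class. -/

def clC0 : Set (Fn Bool Bool) := val clC false false

def clC1 : Set (Fn Bool Bool) := val clC true true

def clLeq : Set (Fn Bool Bool) := leqPart clAll

def clGeq : Set (Fn Bool Bool) := geqPart clAll

def clNeq00 : Set (Fn Bool Bool) := neq00Part clAll

def clNeq11 : Set (Fn Bool Bool) := neq11Part clAll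

def clNeq : Set (Fn Bool Bool) := neqPart clAll

def clEq : Set (Fn Bool Bool) := eqPart clAll

def cl0X : Set (Fn Bool Bool) := valZero clAll false

def cl0XC : Set (Fn Bool Bool) := cl0X ∪ clC

def cl1X : Set (Fn Bool Bool) := valZero clAll true

def cl1XC : Set (Fn Bool Bool) := cl1X ∪ clC

def clX0 : Set (Fn Bool Bool) := valOne clAll false

def clX0C : Set (Fn Bool Bool) := clX0 ∪ clC

def clX1 : Set (Fn Bool Bool) := valOne clAll true

def clX1C : Set (Fn Bool Bool) := clX1 ∪ clC

def cl00 : Set (Fn Bool Bool) := val clAll false false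

def cl00C : Set (Fn Bool Bool) := cl00 ∪ clC

def cl11 : Set (Fn Bool Bool) := val clAll true true

def cl11C : Set (Fn Bool Bool) := cl11 ∪ clC

def cl01 : Set (Fn Bool Bool) := val clAll false true

def cl01C : Set (Fn Bool Bool) := cl01 ∪ clC

def cl01C0 : Set (Fn Bool Bool) := cl01 ∪ clC0

def cl01C1 : Set (Fn Bool Bool) := cl01 ∪ clC1

def cl10 : Set (Fn Bool Bool) := val clAll true false

def cl10C : Set (Fn Bool Bool) := cl10 ∪ clC

def cl10C0 : Set (Fn Bool Bool) := cl10 ∪ clC0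

def cl10C1 : Set (Fn Bool Bool) := cl10 ∪ clC1

def clM0 : Set (Fn Bool Bool) := valZero clM false

def clM1 : Set (Fn Bool Bool) := valOne clM true

def clMc : Set (Fn Bool Bool) := val clM false true

def clMneg : Set (Fn Bool Bool) := negClass clM

def clM0neg : Set (Fn Bool Bool) := negClass clM0

def clM1neg : Set (Fn Bool Bool) := negClass clM1

def clMcneg : Set (Fn Bool Bool) := negClass clMc

def clSminNeq : Set (Fn Bool Bool) := neqPart clSmin

def clSmin0X : Set (Fn Bool Bool) := valZero clSmin false

def clSminX0 : Set (Fn Bool Bool) := valOne clSmin false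

def clSmin01 : Set (Fn Bool Bool) := val clSmin false true

def clSmin10 : Set (Fn Bool Bool) := val clSmin true false

def clSmin00 : Set (Fn Bool Bool) := val clSmin false false

def clSmajNeq : Set (Fn Bool Bool) := neqPart clSmaj

def clSmaj1X : Set (Fn Bool Bool) := valZero clSmaj true

def clSmajX1 : Set (Fn Bool Bool) := valOne clSmaj true

def clSmaj10 : Set (Fn Bool Bool) := val clSmaj true false

def clSmaj01 : Set (Fn Bool Bool) := val clSmaj false true

def clSmaj11 : Set (Fn Bool Bool) := val clSmaj true true

def clSmin01C0 : Set (Fn Bool Bool) := clSmin01 ∪ clC0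

def clSmin10C0 : Set (Fn Bool Bool) := clSmin10 ∪ clC0

def clSmaj10C1 : Set (Fn Bool Bool) := clSmaj10 ∪ clC1

def clSmaj01C1 : Set (Fn Bool Bool) := clSmaj01 ∪ clC1

def clSc : Set (Fn Bool Bool) := val clS false true

def clScneg : Set (Fn Bool Bool) := negClass clSc

def clSM : Set (Fn Bool Bool) := clS ∩ clM

def clSMneg : Set (Fn Bool Bool) := negClass clSM

def clTcU : Set (Fn Bool Bool) := val clU false true

def clMU : Set (Fn Bool Bool) := clM ∩ clU

def clMcU : Set (Fn Bool Bool) := clMc ∩ clU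

def clTcUC0 : Set (Fn Bool Bool) := clTcU ∪ clC0

def clU00 : Set (Fn Bool Bool) := val clU false false

def clUneg : Set (Fn Bool Bool) := negClass clU

def clTcUneg : Set (Fn Bool Bool) := negClass clTcU

def clMUneg : Set (Fn Bool Bool) := negClass clMU

def clMcUneg : Set (Fn Bool Bool) := negClass clMcU

def clTcUnegC1 : Set (Fn Bool Bool) := clTcUneg ∪ clC1

def clUneg11 : Set (Fn Bool Bool) := val clUneg true true

def clTcW : Set (Fn Bool Bool) := val clW false true

def clMW : Set (Fn Bool Bool) := clM ∩ clW

def clMcW : Set (Fn Bool Bool) := clMc ∩ clW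

def clTcWC1 : Set (Fn Bool Bool) := clTcW ∪ clC1

def clW11 : Set (Fn Bool Bool) := val clW true true

def clWneg : Set (Fn Bool Bool) := negClass clW

def clTcWneg : Set (Fn Bool Bool) := negClass clTcW

def clMWneg : Set (Fn Bool Bool) := negClass clMW

def clMcWneg : Set (Fn Bool Bool) := negClass clMcW

def clTcWnegC0 : Set (Fn Bool Bool) := clTcWneg ∪ clC0

def clWneg00 : Set (Fn Bool Bool) := val clWneg false false

def clUWneg : Set (Fn Bool Bool) := clU ∩ clWneg

def clWUneg : Set (Fn Bool Bool) := clW ∩ clUneg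

def clR00 : Set (Fn Bool Bool) := val clR false false

def clR11 : Set (Fn Bool Bool) := val clR true true

def clR00C : Set (Fn Bool Bool) := clR00 ∪ clC

def clR11C : Set (Fn Bool Bool) := clR11 ∪ clC

end BoolClass

open BoolClass

/-! The clone `S ∩ M` contains the ternary majority function. By the Baker–Pixley argument, a class
closed under minors and majority is therefore determined by what its members do on pairs of points.
What they can do on a pair `(a, b)` depends only on the set `T ⊆ {0,1}²` of columns `(aᵢ, bᵢ)`.
Hence such a class `F` is determined by its profile, the map sending each `T` to the set of pairs
`(f(a), f(b))` with `f ∈ F` and columns in `T`. A profile is a 64-bit number, and inclusion of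
profiles is bitwise. `eq_ofProfile_profile` recovers `F` from its profile.

Every entry of the profile of a function is already realized by a ternary minor (`exists_ternary`).
So every profile is a union of profiles of ternary functions. The 256 ternary functions have 30
profiles, and the unions of these, the empty one included, are 93 numbers
(`profile_mem_stableProfiles`). Each of the 93 is the profile of the class it defines
(`profile_ofProfile`), so they correspond to 93 different classes.

Composition acts on profiles as composition of maps `T ↦ T'` (`comp_ofProfile_subset_iff`). Being a
clone and being stable under a clone thus become finite computations with 93 numbers. A clone above
`S ∩ M` is stable under itself, so it is among the 93 classes too. It remains to match the named
classes with profiles. Membership of `f` in each of them can be read off the profile of `{f}`, which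
again has at most 93 possible values (`HasProfile.of_test`). -/

namespace BoolClass

/-! Pairs of points and their columns: the sets `T` of pairs of Booleans are coded by the numbers
below `16`. -/

/-- The number `2x + y` of the pair `(x, y)`. -/
def pairCode (x y : Bool) : ℕ := 2 * x.toNat + y.toNat

theorem pairCode_lt (x y : Bool) : pairCode x y < 4 := by
  cases x <;> cases y <;> decide

theorem pairCode_inj {x y x' y' : Bool} : pairCode x y = pairCode x' y' ↔ x = x' ∧ y = y' := by
  revert x y x' y'; decide

theorem exists_pairCode {v : ℕ} (hv : v < 4) : ∃ x y, pairCode x y = v := by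
  revert v; decide

theorem pairCode_pos {n m : ℕ} (h : n < 4 * m) : ∃ T < m, ∃ x y, n = 4 * T + pairCode x y := by
  obtain ⟨x, y, h'⟩ := exists_pairCode (Nat.mod_lt n (by norm_num : 0 < 4))
  exact ⟨n / 4, by omega, x, y, by omega⟩

/-- The bits of a number, as a table indexed by a number and a pair of Booleans. -/
def bits (m T : ℕ) (x y : Bool) : Bool := m.testBit (4 * T + pairCode x y)

theorem bits_ext {m k : ℕ} (hm : m < 2 ^ 64) (hk : k < 2 ^ 64)
    (h : ∀ T < 16, ∀ x y, bits m T x y = bits k T x y) : m = k := by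
  refine Nat.eq_of_testBit_eq fun i => ?_
  by_cases hi : i < 4 * 16
  · obtain ⟨T, hT, x, y, rfl⟩ := pairCode_pos hi
    exact h T hT x y
  · have h2 : 2 ^ 64 ≤ 2 ^ i := Nat.pow_le_pow_right (by norm_num) (by omega)
    rw [Nat.testBit_lt_two_pow (hm.trans_le h2), Nat.testBit_lt_two_pow (hk.trans_le h2)]

theorem bits_or (m k T : ℕ) (x y : Bool) :
    bits (m ||| k) T x y = (bits m T x y || bits k T x y) := by
  simp [bits]

/-- Inclusion of profiles is written as an equation between numbers, which the kernel evaluates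
quickly. -/
theorem or_eq_right_iff {m k : ℕ} (hm : m < 2 ^ 64) (hk : k < 2 ^ 64) :
    m ||| k = k ↔ ∀ T < 16, ∀ x y, bits m T x y = true → bits k T x y = true := by
  constructor
  · intro h T _ x y hb
    rw [← h, bits_or, hb, Bool.true_or]
  · intro h
    refine bits_ext (Nat.or_lt_two_pow hm hk) hk fun T hT x y => ?_
    rw [bits_or]
    have := h T hT x y
    revert this
    cases bits m T x y <;> cases bits k T x y <;> simp

/-- All pairs `(aᵢ, bᵢ)` belong to `T`. -/
def ColsIn {n : ℕ} (T : ℕ) (a b : Fin n → Bool) : Prop :=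
  ∀ i, T.testBit (pairCode (a i) (b i)) = true

instance {n : ℕ} (T : ℕ) (a b : Fin n → Bool) : Decidable (ColsIn T a b) :=
  inferInstanceAs (Decidable (∀ i, T.testBit (pairCode (a i) (b i)) = true))

open Classical in
/-- The profile of a class records which pairs `(f(a), f(b))`, `f ∈ F`, arise from points `a`, `b`
with columns in `T`, for all `T`. -/
noncomputable def profile (F : Set (Fn Bool Bool)) : ℕ :=
  Nat.ofBits fun i : Fin 64 => decide (∃ f ∈ F, ∃ a b, ColsIn (i / 4) a b ∧
    pairCode (f.2 a) (f.2 b) = i % 4)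

theorem profile_lt (F : Set (Fn Bool Bool)) : profile F < 2 ^ 64 := Nat.ofBits_lt_two_pow _

theorem bits_profile {F : Set (Fn Bool Bool)} {T : ℕ} (hT : T < 16) (x y : Bool) :
    bits (profile F) T x y = true ↔
      ∃ f ∈ F, ∃ a b, ColsIn T a b ∧ f.2 a = x ∧ f.2 b = y := by
  have hv := pairCode_lt x y
  rw [bits, profile, Nat.testBit_ofBits_lt _ _ (by omega)]
  simp only [decide_eq_true_eq]
  have h1 : (4 * T + pairCode x y) / 4 = T := by omega
  have h2 : (4 * T + pairCode x y) % 4 = pairCode x y := by omega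
  simp only [h1, h2, pairCode_inj]

theorem bits_profile_singleton {f : Fn Bool Bool} {T : ℕ} (hT : T < 16) (x y : Bool) :
    bits (profile {f}) T x y = true ↔ ∃ a b, ColsIn T a b ∧ f.2 a = x ∧ f.2 b = y := by
  simp [bits_profile hT]

theorem bits_profile_of_le (F : Set (Fn Bool Bool)) {T : ℕ} (hT : 16 ≤ T) (x y : Bool) :
    bits (profile F) T x y = false := by
  rw [bits, profile, Nat.testBit_ofBits_ge _ _ (by omega)]

theorem profile_mono {F G : Set (Fn Bool Bool)} (h : F ⊆ G) :
    profile F ||| profile G = profile G := by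
  rw [or_eq_right_iff (profile_lt _) (profile_lt _)]
  intro T hT x y hb
  rw [bits_profile hT] at hb ⊢
  obtain ⟨f, hf, r⟩ := hb
  exact ⟨f, h hf, r⟩

/-- The functions mapping all pairs of points with columns in `T` into the pairs prescribed by `m`
at `T`, for all `T`. -/
def ofProfile (m : ℕ) : Set (Fn Bool Bool) :=
  {f | ∀ T < 16, ∀ a b, ColsIn T a b → bits m T (f.2 a) (f.2 b) = true}

/-- Membership in `ofProfile m` depends on `f` only through the profile of `{f}`; this makes
`ofProfile` adjoint to `profile`. -/
theorem mem_ofProfile {m : ℕ} (hm : m < 2 ^ 64) {f : Fn Bool Bool} :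
    f ∈ ofProfile m ↔ profile {f} ||| m = m := by
  rw [or_eq_right_iff (profile_lt _) hm]
  constructor
  · intro h T hT x y hb
    obtain ⟨a, b, hab, rfl, rfl⟩ := (bits_profile_singleton hT x y).1 hb
    exact h T hT a b hab
  · intro h T hT a b hab
    exact h T hT _ _ ((bits_profile_singleton hT _ _).2 ⟨a, b, hab, rfl, rfl⟩)

theorem ofProfile_mono {m k : ℕ} (h : m ||| k = k) : ofProfile m ⊆ ofProfile k := by
  intro f hf T hT a b hab
  rw [← h, bits_or, hf T hT a b hab, Bool.true_or]

theorem subset_ofProfile_profile (F : Set (Fn Bool Bool)) : F ⊆ ofProfile (profile F) :=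
  fun f hf _ hT a b hab => (bits_profile hT _ _).2 ⟨f, hf, a, b, hab, rfl, rfl⟩

/-! Minors. -/

/-- Closure under permutation and identification of arguments and under dummy arguments. -/
def MinorClosed (F : Set (Fn Bool Bool)) : Prop :=
  ∀ f ∈ F, ∀ (k : ℕ+) (σ : Fin f.1 → Fin k), (⟨k, fun a => f.2 (a ∘ σ)⟩ : Fn Bool Bool) ∈ F

theorem minorClosed_ofProfile (m : ℕ) : MinorClosed (ofProfile m) :=
  fun _ hf _ σ T hT _ _ hab => hf T hT _ _ fun i => hab (σ i)

theorem minorClosed_of_comp_projections {F : Set (Fn Bool Bool)} (h : comp F clIc ⊆ F) :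
    MinorClosed F := fun f hf k σ =>
  h ⟨f.1, k, f.2, fun i a => a (σ i), hf, fun i => ⟨σ i, fun _ => rfl⟩, rfl⟩

/-- A pair of points can be replaced by any pair of points that has at least the same columns. -/
theorem exists_reindex {n k : ℕ} {a b : Fin n → Bool} {a' b' : Fin k → Bool}
    (h : ∀ i, ∃ j, a' j = a i ∧ b' j = b i) : ∃ σ : Fin n → Fin k, a' ∘ σ = a ∧ b' ∘ σ = b := by
  choose σ hσ using h
  exact ⟨σ, funext fun i => (hσ i).1, funext fun i => (hσ i).2⟩

-- Except for the full set, coded by 15, a set of columns has at most three elements. Three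
-- arguments, with repetitions, therefore suffice to display all of them; the full set needs four.
set_option synthInstance.maxSize 1000 in
theorem exists_points_three : ∀ T < 15, T ≠ 0 → ∃ a b : Fin 3 → Bool, ColsIn T a b ∧
    ∀ x y, T.testBit (pairCode x y) = true → ∃ j, a j = x ∧ b j = y := by
  decide +kernel

set_option synthInstance.maxSize 1000 in
theorem exists_points_four : ∀ T < 16, T ≠ 0 → ∃ a b : Fin 4 → Bool, ColsIn T a b ∧
    ∀ x y, T.testBit (pairCode x y) = true → ∃ j, a j = x ∧ b j = y := by
  decide +kernel

/-- Arities are positive, so at least one column exists. -/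
theorem ColsIn.ne_zero {n : ℕ+} {T : ℕ} {a b : Fin n → Bool} (h : ColsIn T a b) : T ≠ 0 := by
  rintro rfl
  simpa using h ⟨0, n.pos⟩

theorem exists_ternary_of_lt (f : Fn Bool Bool) {T : ℕ} (hT : T < 15) {a b : Fin f.1 → Bool}
    (h : ColsIn T a b) : ∃ (σ : Fin f.1 → Fin 3) (a' b' : Fin 3 → Bool), ColsIn T a' b' ∧
      f.2 (a' ∘ σ) = f.2 a ∧ f.2 (b' ∘ σ) = f.2 b := by
  obtain ⟨a', b', hT', hab⟩ := exists_points_three T hT h.ne_zero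
  obtain ⟨σ, rfl, rfl⟩ := exists_reindex fun i => hab _ _ (h i)
  exact ⟨σ, a', b', hT', rfl, rfl⟩

theorem colsIn_fifteen {n : ℕ} (a b : Fin n → Bool) : ColsIn 15 a b := by
  intro i
  cases a i <;> cases b i <;> decide

/-- Ternary minors realize all entries of the profile of a function. -/
theorem exists_ternary (f : Fn Bool Bool) {T : ℕ} (hT : T < 16) {a b : Fin f.1 → Bool}
    (h : ColsIn T a b) : ∃ (σ : Fin f.1 → Fin 3) (a' b' : Fin 3 → Bool), ColsIn T a' b' ∧
      f.2 (a' ∘ σ) = f.2 a ∧ f.2 (b' ∘ σ) = f.2 b := by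
  rcases Nat.lt_or_ge T 15 with hT' | hT'
  · exact exists_ternary_of_lt f hT' h
  obtain rfl : T = 15 := by omega
  -- The full set of columns imposes no condition, so the points may be changed as long as the two
  -- values stay. Equal values are taken at `a` twice (columns 00 and 11, code 9). Otherwise `⊥` has
  -- one of the two values and replaces that point (columns 00, 01 with code 3, or 00, 10 with code
  -- 5).
  have key : ∃ T < 15, ∃ c d : Fin f.1 → Bool, ColsIn T c d ∧ f.2 c = f.2 a ∧ f.2 d = f.2 b := by
    by_cases h1 : f.2 a = f.2 b
    · exact ⟨9, by norm_num, a, a, fun i => by cases a i <;> decide, rfl, h1⟩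
    by_cases h2 : f.2 ⊥ = f.2 a
    · exact ⟨3, by norm_num, ⊥, b, fun i => by simp only [Pi.bot_apply]; cases b i <;> decide,
        h2, rfl⟩
    · refine ⟨5, by norm_num, a, ⊥, fun i => by simp only [Pi.bot_apply]; cases a i <;> decide,
        rfl, ?_⟩
      revert h1 h2
      cases f.2 a <;> cases f.2 b <;> cases f.2 ⊥ <;> simp
  obtain ⟨T, hT, c, d, hcd, h1, h2⟩ := key
  obtain ⟨σ, a', b', -, h3, h4⟩ := exists_ternary_of_lt f hT hcd
  exact ⟨σ, a', b', colsIn_fifteen _ _, h3.trans h1, h4.trans h2⟩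

/-! Ternary functions. -/

/-- The ternary function with value table `c`. -/
def ternary (c : ℕ) (a : Fin 3 → Bool) : Bool :=
  c.testBit (4 * (a 0).toNat + 2 * (a 1).toNat + (a 2).toNat)

theorem exists_point : ∀ p < 8, ∃ a : Fin 3 → Bool,
    4 * (a 0).toNat + 2 * (a 1).toNat + (a 2).toNat = p := by
  decide +kernel

theorem point_lt (a : Fin 3 → Bool) : 4 * (a 0).toNat + 2 * (a 1).toNat + (a 2).toNat < 8 := by
  have := Bool.toNat_le (a 0)
  have := Bool.toNat_le (a 1)
  have := Bool.toNat_le (a 2)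
  omega

theorem point_injective : ∀ a b : Fin 3 → Bool, 4 * (a 0).toNat + 2 * (a 1).toNat + (a 2).toNat =
    4 * (b 0).toNat + 2 * (b 1).toNat + (b 2).toNat → a = b := by
  decide +kernel

theorem exists_ternary_eq (g : (Fin 3 → Bool) → Bool) : ∃ c < 256, ternary c = g := by
  choose P hP using exists_point
  refine ⟨Nat.ofBits fun i : Fin 8 => g (P i i.2), Nat.ofBits_lt_two_pow _, ?_⟩
  funext a
  rw [ternary, Nat.testBit_ofBits_lt _ _ (point_lt a)]
  exact congrArg g (point_injective _ _ (hP _ _))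

/-- The code of the set of columns of two points of `{0,1}³`, given by their numbers. -/
def columns (p q : ℕ) : ℕ :=
  1 <<< pairCode (p.testBit 2) (q.testBit 2) ||| 1 <<< pairCode (p.testBit 1) (q.testBit 1) |||
    1 <<< pairCode (p.testBit 0) (q.testBit 0)

/-- The sum of `16 ^ T'` over the supersets `T'` of `T`. -/
def supersets (T : ℕ) : ℕ :=
  (16 + (!T.testBit 0).toNat) * (16 ^ 2 + (!T.testBit 1).toNat) *
    (16 ^ 4 + (!T.testBit 2).toNat) * (16 ^ 8 + (!T.testBit 3).toNat)

/-- Two points with column set exactly `S` contribute to the entry at every `T ⊇ S`. In the product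
defining `supersets`, the factor for the pair with code `j` is `16 ^ 2 ^ j` if the pair lies in `S`,
and has an additional summand 1 if it is optional. Expanding gives one hexadecimal digit for each
superset, and the shift moves its bit to the pair of values. -/
theorem bits_supersets_shiftLeft : ∀ S < 16, ∀ T < 16, ∀ x y x' y',
    bits (supersets S <<< pairCode x y) T x' y' = (S ||| T == T && (x == x' && y == y')) := by
  decide +kernel

/-- The profile of the ternary function with value table `c`. -/
def ternaryProfile (c : ℕ) : ℕ :=
  (List.range 64).foldr (fun k m => m ||| supersets (columns (k / 8) (k % 8)) <<<
    pairCode (c.testBit (k / 8)) (c.testBit (k % 8))) 0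

theorem columns_lt : ∀ p < 8, ∀ q < 8, columns p q < 16 := by decide +kernel

theorem columns_or_eq_iff : ∀ a b : Fin 3 → Bool, ∀ T < 16,
    (columns (4 * (a 0).toNat + 2 * (a 1).toNat + (a 2).toNat)
      (4 * (b 0).toNat + 2 * (b 1).toNat + (b 2).toNat) ||| T = T ↔ ColsIn T a b) := by
  decide +kernel

theorem bits_foldr_or {α : Type*} (g : α → ℕ) (l : List α) (T : ℕ) (x y : Bool) :
    bits (l.foldr (fun k m => m ||| g k) 0) T x y = true ↔ ∃ k ∈ l, bits (g k) T x y = true := by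
  induction l with
  | nil => simp [bits]
  | cons k l ih => simp [bits_or, ih, or_comm]

theorem bits_ternaryProfile (c : ℕ) {T : ℕ} (hT : T < 16) (x y : Bool) :
    bits (ternaryProfile c) T x y = true ↔
      ∃ a b, ColsIn T a b ∧ ternary c a = x ∧ ternary c b = y := by
  rw [ternaryProfile, bits_foldr_or]
  constructor
  · rintro ⟨k, hk, h⟩
    have hk : k < 64 := List.mem_range.1 hk
    have hp : k / 8 < 8 := by omega
    have hq : k % 8 < 8 := by omega
    rw [bits_supersets_shiftLeft _ (columns_lt _ hp _ hq) _ hT] at h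
    simp only [Bool.and_eq_true, beq_iff_eq] at h
    obtain ⟨a, ha⟩ := exists_point _ hp
    obtain ⟨b, hb⟩ := exists_point _ hq
    rw [← ha, ← hb] at h
    exact ⟨a, b, (columns_or_eq_iff a b T hT).1 h.1, h.2.1, h.2.2⟩
  · rintro ⟨a, b, hab, rfl, rfl⟩
    have ha := point_lt a
    have hb := point_lt b
    set p := 4 * (a 0).toNat + 2 * (a 1).toNat + (a 2).toNat with hp
    set q := 4 * (b 0).toNat + 2 * (b 1).toNat + (b 2).toNat with hq
    refine ⟨8 * p + q, List.mem_range.2 (by omega), ?_⟩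
    have h1 : (8 * p + q) / 8 = p := by omega
    have h2 : (8 * p + q) % 8 = q := by omega
    rw [h1, h2, bits_supersets_shiftLeft _ (columns_lt _ ha _ hb) _ hT]
    simp only [Bool.and_eq_true, beq_iff_eq]
    exact ⟨(columns_or_eq_iff a b T hT).2 hab, rfl, rfl⟩

/-! The profiles of all classes. -/

/-- Value tables of ternary functions and their profiles; all profiles of ternary functions occur. -/
def ternaryProfiles : List (ℕ × ℕ) :=
  [(0, 0x1111111111111110), (255, 0x8888888888888880), (15, 0xf7b3d591e6a2c480),
   (1, 0xf7b3d591f7a2c480), (2, 0xf7f3f59177513110), (6, 0xf7f3f591f7513110),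
   (9, 0xf7f3f591f7a2c480), (170, 0xfedcba9876543210), (234, 0xfedcba98fe543210),
   (175, 0xfefcfa98eea8c880), (174, 0xfefcfa98fe543210), (171, 0xfefcfa98fea8c880),
   (31, 0xffb3d591eea2c480), (128, 0xffdcba9877543210), (40, 0xfff3f59177513110),
   (47, 0xfff3f591eea2c480), (43, 0xfff3f591f6a2c480), (41, 0xfff3f591f7a2c480),
   (24, 0xfff3f591f9513110), (107, 0xfff3f591fea2c480), (26, 0xfff3f591ff513110),
   (25, 0xfff3f591ffa2c480), (130, 0xfffcfa9877543210), (143, 0xfffcfa98eea8c880),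
   (142, 0xfffcfa98f6543210), (134, 0xfffcfa98f7543210), (129, 0xfffcfa98f9a8c880),
   (158, 0xfffcfa98fe543210), (152, 0xfffcfa98ff543210), (131, 0xfffcfa98ffa8c880)]

/-- The profiles of the `(I_c, S ∩ M)`-stable classes. -/
def stableProfiles : List ℕ :=
  [0xffffff99ffffff90, 0xffffff99fffdfb90, 0xffffff99fffbfd90, 0xffffff99fff7f790,
   0xffffff99fffefe90, 0xffffff99ffddbb90, 0xfffbfd99fffbfd90, 0xfffbfd99ffd9b990,
   0xfffdfb99ffddbb90, 0xfffdfb99ff553310, 0xfffcfa98ffdcba90, 0xffffff99ffbbdd90,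
   0xfffdfb99fffdfb90, 0xfffdfb99ffb9d990, 0xfffbfd99ffbbdd90, 0xfffbfd99ffaacc80,
   0xfff3f591ffb3d590, 0xffffff99fff6f690, 0xffffff99fff9f990, 0xffffff99ff553310,
   0xffffff99ffaacc80, 0xfff3f591fff3f590, 0xfffcfa98fffcfa90, 0xfff3f591ff513110,
   0xfffcfa98ffa8c880, 0xfffcfa98ff543210, 0xfff3f591ffa2c480, 0xffddbb99ffddbb90,
   0xffddbb99ff553310, 0xffdcba98ffdcba90, 0xffdcba98ff543210, 0xffbbdd99ffbbdd90,
   0xffbbdd99ffaacc80, 0xffb3d591ffb3d590, 0xffb3d591ffa2c480, 0xffffff99f7f7f790,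
   0xffffff99f7f6f690, 0xffffff99f7553310, 0xfff3f591f7f3f590, 0xfffdfb99f7553310,
   0xfff3f591f7b3d590, 0xfffcfa98f7543210, 0xfff3f591f7a2c480, 0xfff3f591f7513110,
   0xffffff99fefefe90, 0xffffff99fef6f690, 0xffffff99feaacc80, 0xfffcfa98fefcfa90,
   0xfffbfd99feaacc80, 0xfffcfa98fedcba90, 0xfff3f591fea2c480, 0xfffcfa98fe543210,
   0xfffcfa98fea8c880, 0xffffff99f6f6f690, 0xfffcfa98f6543210, 0xfff3f591f6a2c480,
   0xfedcba9876543210, 0xf7b3d591e6a2c480, 0xffffff9977553310, 0xfffdfb9977553310,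
   0xfffcfa9877543210, 0xffddbb9977553310, 0xffdcba9877543210, 0xfff3f59177513110,
   0xffffff99eeaacc80, 0xfffbfd99eeaacc80, 0xfff3f591eea2c480, 0xffbbdd99eeaacc80,
   0xffb3d591eea2c480, 0xfffcfa98eea8c880, 0xfefcfa98fefcfa90, 0xfefcfa98fedcba90,
   0xfefcfa98fe543210, 0xfedcba98fedcba90, 0xfedcba98fe543210, 0xfefcfa98fea8c880,
   0xf7f3f591f7f3f590, 0xf7f3f591f7b3d590, 0xf7f3f591f7a2c480, 0xf7b3d591f7b3d590,
   0xf7b3d591f7a2c480, 0xf7f3f591f7513110, 0xf7f3f59177513110, 0xfefcfa98eea8c880,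
   0xffffff99f9f9f990, 0xfffbfd99f9d9b990, 0xfffdfb99f9b9d990, 0xfff3f591f9513110,
   0xfffcfa98f9a8c880, 0x9999999999999990, 0x1111111111111110, 0x8888888888888880, 0x0]

theorem lt_of_mem_stableProfiles : ∀ m ∈ stableProfiles, m < 2 ^ 64 := by decide +kernel

theorem lt_of_mem_ternaryProfiles : ∀ t ∈ ternaryProfiles, t.2 < 2 ^ 64 := by decide +kernel

theorem ternaryProfile_of_mem : ∀ t ∈ ternaryProfiles, ternaryProfile t.1 = t.2 := by
  decide +kernel

theorem exists_mem_ternaryProfiles : ∀ c < 256, ∃ t ∈ ternaryProfiles, ternaryProfile c = t.2 := by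
  decide +kernel

/-- Adding one ternary function at a time never leaves the list; together with the empty profile
this covers arbitrary unions. -/
theorem or_mem_stableProfiles :
    ∀ t ∈ ternaryProfiles, ∀ m ∈ stableProfiles, m ||| t.2 ∈ stableProfiles := by
  have h : (ternaryProfiles.all fun t => stableProfiles.all fun m =>
    stableProfiles.contains (m ||| t.2)) = true := by decide +kernel
  simpa only [List.all_eq_true, List.contains_iff_mem] using h

theorem foldr_or_mem_stableProfiles (l : List ℕ) (hl : ∀ c ∈ l, c < 256) :
    l.foldr (fun c m => m ||| ternaryProfile c) 0 ∈ stableProfiles := by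
  induction l with
  | nil => decide
  | cons c l ih =>
    obtain ⟨t, ht, h⟩ := exists_mem_ternaryProfiles c (hl c (by simp))
    rw [List.foldr_cons, h]
    exact or_mem_stableProfiles t ht _ (ih fun d hd => hl d (by simp [hd]))

/-- No stability is needed: the profile of any class is the union of the profiles of all ternary
minors of its members. -/
theorem profile_mem_stableProfiles (F : Set (Fn Bool Bool)) : profile F ∈ stableProfiles := by
  classical
  let l := (List.range 256).filter fun c =>
    decide (∃ f ∈ F, ∃ σ : Fin f.1 → Fin 3, ∀ a, ternary c a = f.2 (a ∘ σ))
  have hl : l.foldr (fun c m => m ||| ternaryProfile c) 0 ∈ stableProfiles :=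
    foldr_or_mem_stableProfiles l fun c hc => List.mem_range.1 (List.mem_filter.1 hc).1
  convert hl using 1
  refine bits_ext (profile_lt F) (lt_of_mem_stableProfiles _ hl) fun T hT x y => ?_
  rw [Bool.eq_iff_iff, bits_profile hT, bits_foldr_or]
  constructor
  · rintro ⟨f, hf, a, b, hab, rfl, rfl⟩
    obtain ⟨σ, a', b', hab', h1, h2⟩ := exists_ternary f hT hab
    obtain ⟨c, hc, h⟩ := exists_ternary_eq fun a => f.2 (a ∘ σ)
    refine ⟨c, List.mem_filter.2 ⟨List.mem_range.2 hc, decide_eq_true ⟨f, hf, σ, congrFun h⟩⟩, ?_⟩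
    rw [bits_ternaryProfile c hT, h]
    exact ⟨a', b', hab', h1, h2⟩
  · rintro ⟨c, hc, h⟩
    obtain ⟨f, hf, σ, hσ⟩ := of_decide_eq_true (List.mem_filter.1 hc).2
    obtain ⟨a, b, hab, rfl, rfl⟩ := (bits_ternaryProfile c hT x y).1 h
    exact ⟨f, hf, a ∘ σ, b ∘ σ, fun i => hab (σ i), (hσ a).symm, (hσ b).symm⟩

theorem profile_ternary {t : ℕ × ℕ} (ht : t ∈ ternaryProfiles) :
    profile {⟨3, ternary t.1⟩} = t.2 := by
  refine bits_ext (profile_lt _) (lt_of_mem_ternaryProfiles t ht) fun T hT x y => ?_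
  rw [← ternaryProfile_of_mem t ht, Bool.eq_iff_iff, bits_profile_singleton hT,
    bits_ternaryProfile _ hT]
  rfl

/-- Each listed number is the union of the ternary profiles below it, so none of its bits is
unattainable. -/
theorem stableProfiles_eq_foldr : ∀ m ∈ stableProfiles,
    (ternaryProfiles.filter fun t => t.2 ||| m == m).foldr (fun t k => k ||| t.2) 0 = m := by
  decide +kernel

/-- Each bit of `m` comes from a ternary function with profile below `m`, and that function belongs
to `ofProfile m`. -/
theorem profile_ofProfile {m : ℕ} (hm : m ∈ stableProfiles) : profile (ofProfile m) = m := by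
  refine bits_ext (profile_lt _) (lt_of_mem_stableProfiles m hm) fun T hT x y => ?_
  rw [Bool.eq_iff_iff]
  constructor
  · intro h
    obtain ⟨f, hf, a, b, hab, rfl, rfl⟩ := (bits_profile hT x y).1 h
    exact hf T hT a b hab
  · intro h
    rw [← stableProfiles_eq_foldr m hm, bits_foldr_or] at h
    obtain ⟨t, ht, hb⟩ := h
    obtain ⟨ht, hle⟩ := List.mem_filter.1 ht
    rw [← profile_ternary ht] at hb hle
    obtain ⟨a, b, hab, rfl, rfl⟩ := (bits_profile_singleton hT x y).1 hb
    refine (bits_profile hT _ _).2 ⟨_, ?_, a, b, hab, rfl, rfl⟩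
    exact (mem_ofProfile (lt_of_mem_stableProfiles m hm)).2 (beq_iff_eq.1 hle)

theorem ofProfile_injOn : Set.InjOn ofProfile {m | m ∈ stableProfiles} := by
  intro m hm k hk h
  rw [← profile_ofProfile hm, h, profile_ofProfile hk]

/-! Classes stable under minors and majority are determined by their profiles. -/

/-- The majority of three Booleans. -/
def majority (a : Fin 3 → Bool) : Bool := (a 0 && a 1) || (a 0 && a 2) || (a 1 && a 2)

theorem majority_mem_clSM : (⟨3, majority⟩ : Fn Bool Bool) ∈ clSM := by
  refine ⟨show ∀ a : Fin 3 → Bool, majority a = (majority aᶜ)ᶜ by decide +kernel,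
    show ∀ a b : Fin 3 → Bool, (∀ i, a i ≤ b i) → majority a ≤ majority b by
      decide +kernel⟩

theorem majority_mem {F : Set (Fn Bool Bool)} (hF : comp clSM F ⊆ F) {n : ℕ+}
    {g : Fin 3 → (Fin n → Bool) → Bool} (hg : ∀ i, (⟨n, g i⟩ : Fn Bool Bool) ∈ F) :
    (⟨n, fun a => majority fun i => g i a⟩ : Fn Bool Bool) ∈ F :=
  hF ⟨3, n, majority, g, majority_mem_clSM, hg, rfl⟩

theorem exists_eq_on_pair {F : Set (Fn Bool Bool)} (hF : MinorClosed F) {f : Fn Bool Bool}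
    (hf : f ∈ ofProfile (profile F)) (a b : Fin f.1 → Bool) :
    ∃ g : (Fin f.1 → Bool) → Bool, (⟨f.1, g⟩ : Fn Bool Bool) ∈ F ∧ g a = f.2 a ∧ g b = f.2 b := by
  classical
  -- `T` codes exactly the set of columns of `a` and `b`. A witness for the entry at `T` then lives
  -- on points all of whose columns occur among these, so a minor of it moves to `a` and `b`.
  let T := Nat.ofBits fun v : Fin 4 => decide (∃ i, pairCode (a i) (b i) = v)
  have hT : T < 16 := Nat.ofBits_lt_two_pow _
  have hbit : ∀ x y, T.testBit (pairCode x y) = true ↔ ∃ i, a i = x ∧ b i = y := by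
    intro x y
    rw [Nat.testBit_ofBits_lt _ _ (pairCode_lt x y)]
    simp [pairCode_inj]
  have := hf T hT a b fun i => (hbit _ _).2 ⟨i, rfl, rfl⟩
  obtain ⟨h, hh, a', b', hab', h1, h2⟩ := (bits_profile hT _ _).1 this
  obtain ⟨σ, rfl, rfl⟩ := exists_reindex fun j => (hbit _ _).1 (hab' j)
  exact ⟨fun c => h.2 (c ∘ σ), hF h hh f.1 σ, h1, h2⟩

/-- Baker–Pixley: `f` is interpolated by members of `F` on larger and larger sets of points,
starting from sets of at most two. -/
theorem eq_ofProfile_profile {F : Set (Fn Bool Bool)} (hF : IsStable clIc clSM F) :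
    F = ofProfile (profile F) := by
  classical
  refine (subset_ofProfile_profile F).antisymm fun f hf => ?_
  have hm := minorClosed_of_comp_projections hF.1
  have key : ∀ s : Finset (Fin f.1 → Bool),
      ∃ g : (Fin f.1 → Bool) → Bool, (⟨f.1, g⟩ : Fn Bool Bool) ∈ F ∧ ∀ a ∈ s, g a = f.2 a := by
    intro s
    induction s using Finset.strongInduction with
    | H s ih =>
      by_cases hs : 2 < s.card
      · obtain ⟨a, ha, b, hb, c, hc, hab, hac, hbc⟩ := Finset.two_lt_card.1 hs
        obtain ⟨g₁, hg₁, h₁⟩ := ih _ (Finset.erase_ssubset ha)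
        obtain ⟨g₂, hg₂, h₂⟩ := ih _ (Finset.erase_ssubset hb)
        obtain ⟨g₃, hg₃, h₃⟩ := ih _ (Finset.erase_ssubset hc)
        refine ⟨_, majority_mem hF.2 (g := ![g₁, g₂, g₃])
          (by intro i; fin_cases i <;> assumption), fun d hd => ?_⟩
        simp only [Finset.mem_erase, and_imp] at h₁ h₂ h₃
        simp only [majority, Matrix.cons_val]
        by_cases h1 : d = a
        · rw [h₂ d (h1 ▸ hab) hd, h₃ d (h1 ▸ hac) hd]
          cases f.2 d <;> simp
        · rw [h₁ d h1 hd]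
          by_cases h2 : d = b
          · rw [h₃ d (h2 ▸ hbc) hd]
            cases f.2 d <;> simp
          · rw [h₂ d h2 hd]
            cases f.2 d <;> simp
      · obtain ⟨a, b, hab⟩ : ∃ a b, s ⊆ {a, b} := by
          rcases Nat.lt_or_ge s.card 2 with h | h
          · obtain ⟨a, ha⟩ := Finset.card_le_one_iff_subset_singleton.1 (Nat.le_of_lt_succ h)
            exact ⟨a, a, by simpa using ha⟩
          · obtain ⟨a, b, -, rfl⟩ := Finset.card_eq_two.1 (by omega : s.card = 2)
            exact ⟨a, b, subset_rfl⟩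
        obtain ⟨g, hg, ha, hb⟩ := exists_eq_on_pair hm hf a b
        refine ⟨g, hg, fun d hd => ?_⟩
        rcases Finset.mem_insert.1 (hab hd) with rfl | h
        · exact ha
        · rwa [Finset.mem_singleton.1 h]
  obtain ⟨g, hg, h⟩ := key Finset.univ
  obtain rfl : g = f.2 := funext fun a => h a (Finset.mem_univ a)
  exact hg

/-! Composition on the level of profiles. -/

/-- The part of a profile at `T`. -/
def part (m T : ℕ) : ℕ := (m >>> (4 * T)) % 2 ^ 4

theorem part_lt (m T : ℕ) : part m T < 16 := Nat.mod_lt _ (by norm_num)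

/-- A part of a profile is itself the code of a set of pairs, so it can serve as index into another
profile. -/
theorem testBit_part (m T : ℕ) (x y : Bool) : (part m T).testBit (pairCode x y) = bits m T x y := by
  rw [part, bits, Nat.testBit_mod_two_pow, Nat.testBit_shiftRight, decide_eq_true (pairCode_lt x y),
    Bool.true_and]

/-- The composition of the profiles `m` and `c` is contained in `k`. -/
def compLe (m c k : ℕ) : Bool :=
  (List.range 16).all fun T => part m (part c T) ||| part k T == part k T

theorem compLe_iff {m c k : ℕ} : compLe m c k = true ↔
    ∀ T < 16, ∀ x y, bits m (part c T) x y = true → bits k T x y = true := by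
  simp only [compLe, List.all_eq_true, List.mem_range, beq_iff_eq]
  refine forall₂_congr fun T _ => ⟨fun h x y hb => ?_, fun h => ?_⟩
  · rw [← testBit_part, ← h, Nat.testBit_or, testBit_part, hb, Bool.true_or]
  · refine Nat.eq_of_testBit_eq fun i => ?_
    by_cases hi : i < 4
    · obtain ⟨x, y, rfl⟩ := exists_pairCode hi
      have := h x y
      rw [Nat.testBit_or, testBit_part, testBit_part]
      revert this
      cases bits m (part c T) x y <;> cases bits k T x y <;> simp
    · rw [Nat.testBit_or, part, Nat.testBit_mod_two_pow, decide_eq_false hi, Bool.false_and,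
        Bool.false_or]

/-- Inner functions send columns in `T` to columns in `part c T`, and the outer function sends these
to pairs in the entry of `m` there. Conversely, every such pair is attained by an actual
composition, because both profiles are attained. -/
theorem comp_ofProfile_subset_iff {m c k : ℕ} (hm : m ∈ stableProfiles) (hc : c ∈ stableProfiles) :
    comp (ofProfile m) (ofProfile c) ⊆ ofProfile k ↔ compLe m c k = true := by
  rw [compLe_iff]
  constructor
  · intro h T hT x y hb
    rw [← profile_ofProfile hm, bits_profile (part_lt _ _)] at hb
    obtain ⟨f, hf, a, b, hab, rfl, rfl⟩ := hb
    have hg : ∀ i, ∃ g ∈ ofProfile c, ∃ a' b', ColsIn T a' b' ∧ g.2 a' = a i ∧ g.2 b' = b i := by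
      intro i
      rw [← bits_profile hT, profile_ofProfile hc, ← testBit_part]
      exact hab i
    obtain ⟨_, _, _, _, h0, -⟩ := hg ⟨0, f.1.pos⟩
    -- The inner functions must share one arity and be evaluated at one pair of points. Four
    -- arguments can display all of `T`, so each inner function has a minor that takes its values at
    -- `p` and `q`.
    obtain ⟨p, q, hpq, hp⟩ := exists_points_four T hT h0.ne_zero
    have hg4 : ∀ i, ∃ g : (Fin 4 → Bool) → Bool, (⟨4, g⟩ : Fn Bool Bool) ∈ ofProfile c ∧
        g p = a i ∧ g q = b i := by
      intro i
      obtain ⟨g, hgc, a', b', hab', h1, h2⟩ := hg i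
      obtain ⟨σ, rfl, rfl⟩ := exists_reindex fun j => hp _ _ (hab' j)
      exact ⟨_, minorClosed_ofProfile c g hgc 4 σ, h1, h2⟩
    choose g hgc h1 h2 using hg4
    have := h ⟨f.1, 4, f.2, g, hf, hgc, rfl⟩ T hT p q hpq
    simpa only [h1, h2] using this
  · rintro h _ ⟨n, l, f, g, hf, hg, rfl⟩ T hT a b hab
    exact h T hT _ _ (hf _ (part_lt c T) _ _ fun i => by
      rw [testBit_part]; exact hg i T hT a b hab)

/-! Recognition of classes by profiles. -/

/-- Membership in `K` is decided by the test `p` on the profile. -/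
class HasTest (K : Set (Fn Bool Bool)) (p : outParam ((ℕ → Bool → Bool → Bool) → Bool)) : Prop where
  mem_iff : ∀ f, f ∈ K ↔ p (bits (profile {f})) = true

/-- The relations between points in the definitions of the basic classes are column sets: code 2 is
{01}, 6 is {01, 10}, 7 is {00, 01, 10}, 11 is {00, 01, 11} and 14 is {01, 10, 11}. -/
theorem colsIn_two {n : ℕ} {a b : Fin n → Bool} : ColsIn 2 a b ↔ a = ⊥ ∧ b = ⊤ := by
  have h : ∀ x y, (2).testBit (pairCode x y) = true ↔ x = ⊥ ∧ y = ⊤ := by decide +kernel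
  simp [ColsIn, h, funext_iff, forall_and]

theorem colsIn_six {n : ℕ} {a b : Fin n → Bool} : ColsIn 6 a b ↔ b = aᶜ := by
  have h : ∀ x y, (6).testBit (pairCode x y) = true ↔ y = xᶜ := by decide +kernel
  simp [ColsIn, h, funext_iff]

theorem colsIn_seven {n : ℕ} {a b : Fin n → Bool} : ColsIn 7 a b ↔ a ⊓ b = ⊥ := by
  have h : ∀ x y, (7).testBit (pairCode x y) = true ↔ x ⊓ y = ⊥ := by decide +kernel
  simp [ColsIn, h, funext_iff]

theorem colsIn_eleven {n : ℕ} {a b : Fin n → Bool} : ColsIn 11 a b ↔ a ≤ b := by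
  have h : ∀ x y, (11).testBit (pairCode x y) = true ↔ x ≤ y := by decide +kernel
  simp [ColsIn, h, Pi.le_def]

theorem colsIn_fourteen {n : ℕ} {a b : Fin n → Bool} : ColsIn 14 a b ↔ a ⊔ b = ⊤ := by
  have h : ∀ x y, (14).testBit (pairCode x y) = true ↔ x ⊔ y = ⊤ := by decide +kernel
  simp [ColsIn, h, funext_iff]

/-- The value at `0…0`, read off the bits of a profile. -/
def botTest (q : ℕ → Bool → Bool → Bool) : Bool := q 2 true false || q 2 true true

/-- The value at `1…1`, read off the bits of a profile. -/
def topTest (q : ℕ → Bool → Bool → Bool) : Bool := q 2 false true || q 2 true true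

theorem botTest_eq (f : Fn Bool Bool) : botTest (bits (profile {f})) = f.2 ⊥ := by
  rw [Bool.eq_iff_iff, botTest, Bool.or_eq_true, bits_profile_singleton (by norm_num),
    bits_profile_singleton (by norm_num)]
  simp only [colsIn_two]
  constructor
  · rintro (⟨_, _, ⟨rfl, rfl⟩, h, _⟩ | ⟨_, _, ⟨rfl, rfl⟩, h, _⟩) <;> exact h
  · intro h
    cases h' : f.2 ⊤
    · exact .inl ⟨_, _, ⟨rfl, rfl⟩, h, h'⟩
    · exact .inr ⟨_, _, ⟨rfl, rfl⟩, h, h'⟩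

theorem topTest_eq (f : Fn Bool Bool) : topTest (bits (profile {f})) = f.2 ⊤ := by
  rw [Bool.eq_iff_iff, topTest, Bool.or_eq_true, bits_profile_singleton (by norm_num),
    bits_profile_singleton (by norm_num)]
  simp only [colsIn_two]
  constructor
  · rintro (⟨_, _, ⟨rfl, rfl⟩, _, h⟩ | ⟨_, _, ⟨rfl, rfl⟩, _, h⟩) <;> exact h
  · intro h
    cases h' : f.2 ⊥
    · exact .inl ⟨_, _, ⟨rfl, rfl⟩, h', h⟩
    · exact .inr ⟨_, _, ⟨rfl, rfl⟩, h', h⟩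

theorem bits_profile_compl (f : Fn Bool Bool) (T : ℕ) (x y : Bool) :
    bits (profile {(⟨f.1, fun a => (f.2 a)ᶜ⟩ : Fn Bool Bool)}) T x y =
      bits (profile {f}) T (!x) (!y) := by
  rcases Nat.lt_or_ge T 16 with hT | hT
  · rw [Bool.eq_iff_iff, bits_profile_singleton hT, bits_profile_singleton hT]
    simp only [Bool.compl_eq_bnot, Bool.not_eq_eq_eq_not]
  · rw [bits_profile_of_le _ hT, bits_profile_of_le _ hT]

/-! ### Tests for the basic classes -/

instance : HasTest clAll fun _ => true := ⟨by simp [clAll]⟩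

instance : HasTest ∅ fun _ => false := ⟨by simp⟩

instance : HasTest clC fun q => !q 15 false true := ⟨fun f => by
  rw [Bool.not_eq_true', ← Bool.not_eq_true, bits_profile_singleton (by norm_num)]
  constructor
  · rintro ⟨c, hc⟩ ⟨a, b, -, h1, h2⟩
    simp [hc] at h1 h2
    simp [h1] at h2
  · intro h
    cases h0 : f.2 ⊥
    · exact ⟨false, fun a => Bool.eq_false_of_not_eq_true fun ha =>
        h ⟨_, _, colsIn_fifteen _ _, h0, ha⟩⟩
    · exact ⟨true, fun a => Bool.eq_true_of_not_eq_false fun ha =>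
        h ⟨_, _, colsIn_fifteen _ _, ha, h0⟩⟩⟩

instance : HasTest clM fun q => !q 11 true false := ⟨fun f => by
  rw [Bool.not_eq_true', ← Bool.not_eq_true, bits_profile_singleton (by norm_num)]
  simp only [colsIn_eleven, clM, Set.mem_ofPred_eq, Bool.le_iff_imp]
  push Not
  simp only [ne_eq, Bool.not_eq_false]⟩

instance : HasTest clR fun q => !q 6 true false := ⟨fun f => by
  rw [Bool.not_eq_true', ← Bool.not_eq_true, bits_profile_singleton (by norm_num)]
  simp only [colsIn_six, clR, Set.mem_ofPred_eq]
  constructor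
  · rintro h ⟨a, _, rfl, h1, h2⟩
    simp [← h, h1] at h2
  · intro h a
    cases h1 : f.2 a <;> cases h2 : f.2 aᶜ <;> try rfl
    · exact absurd ⟨aᶜ, _, rfl, h2, by rwa [compl_compl]⟩ h
    · exact absurd ⟨a, _, rfl, h1, h2⟩ h⟩

instance : HasTest clSmin fun q => !q 6 true true := ⟨fun f => by
  rw [Bool.not_eq_true', ← Bool.not_eq_true, bits_profile_singleton (by norm_num)]
  simp only [colsIn_six]
  constructor
  · rintro ⟨g, hg, hfg⟩ ⟨a, _, rfl, h1, h2⟩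
    have h3 := hg a
    have h4 := hfg a
    have h5 := hfg aᶜ
    simp only [h1, h2, Bool.le_iff_imp, forall_true_left] at h4 h5
    simp [h4, h5] at h3
  · intro h
    -- A self-dual majorant must be 1 where `f` is 1 and 0 at the complements of such points. Where
    -- `f` vanishes at both `a` and `aᶜ`, the first argument decides.
    refine ⟨fun a => f.2 a || (!f.2 aᶜ && a ⟨0, f.1.pos⟩), fun a => ?_, fun a => ?_⟩
    · have : ¬(f.2 a = true ∧ f.2 aᶜ = true) := fun h' => h ⟨a, _, rfl, h'.1, h'.2⟩
      revert this
      simp only [compl_compl, Pi.compl_apply]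
      cases f.2 a <;> cases f.2 aᶜ <;> cases a ⟨0, f.1.pos⟩ <;> simp
    · cases h' : f.2 a <;> simp [h']⟩

instance : HasTest clSmaj fun q => !q 6 false false := ⟨fun f => by
  rw [Bool.not_eq_true', ← Bool.not_eq_true, bits_profile_singleton (by norm_num)]
  simp only [colsIn_six]
  constructor
  · rintro ⟨g, hg, hfg⟩ ⟨a, _, rfl, h1, h2⟩
    have h3 := hg a
    have h4 := hfg a
    have h5 := hfg aᶜ
    revert h3 h4 h5
    simp only [h1, h2]
    cases g a <;> cases g aᶜ <;> simp
  · intro h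
    -- Dually, the first argument decides where `f` is 1 at both `a` and `aᶜ`.
    refine ⟨fun a => f.2 a && (!f.2 aᶜ || a ⟨0, f.1.pos⟩), fun a => ?_, fun a => ?_⟩
    · have : ¬(f.2 a = false ∧ f.2 aᶜ = false) := fun h' => h ⟨a, _, rfl, h'.1, h'.2⟩
      revert this
      simp only [compl_compl, Pi.compl_apply]
      cases f.2 a <;> cases f.2 aᶜ <;> cases a ⟨0, f.1.pos⟩ <;> simp
    · cases h' : f.2 a <;> simp [h']⟩

instance : HasTest clS fun q => !q 6 false false && !q 6 true true := ⟨fun f => by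
  rw [Bool.and_eq_true, Bool.not_eq_true', ← Bool.not_eq_true, Bool.not_eq_true',
    ← Bool.not_eq_true, bits_profile_singleton (by norm_num), bits_profile_singleton (by norm_num)]
  simp only [colsIn_six, clS, Set.mem_ofPred_eq]
  constructor
  · refine fun h => ⟨?_, ?_⟩ <;>
    · rintro ⟨a, _, rfl, h1, h2⟩
      have := h a
      simp [h1, h2] at this
  · rintro ⟨h0, h1⟩ a
    cases h2 : f.2 a <;> cases h3 : f.2 aᶜ <;> try rfl
    · exact absurd ⟨a, _, rfl, h2, h3⟩ h0
    · exact absurd ⟨a, _, rfl, h2, h3⟩ h1⟩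

instance : HasTest clU fun q => !q 7 true true := ⟨fun f => by
  rw [Bool.not_eq_true', ← Bool.not_eq_true, bits_profile_singleton (by norm_num)]
  simp only [colsIn_seven]
  constructor
  · rintro h ⟨a, b, hab, h1, h2⟩
    refine h ![a, b] (by intro i; fin_cases i <;> assumption) ?_
    simpa [Fin.univ_succ] using hab
  · intro h a ha ha'
    refine h ⟨a 0, a 1, ?_, ha 0, ha 1⟩
    simpa [Fin.univ_succ] using ha'⟩

instance : HasTest clW fun q => !q 14 false false := ⟨fun f => by
  rw [Bool.not_eq_true', ← Bool.not_eq_true, bits_profile_singleton (by norm_num)]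
  simp only [colsIn_fourteen]
  constructor
  · rintro h ⟨a, b, hab, h1, h2⟩
    refine h ![a, b] (by intro i; fin_cases i <;> assumption) ?_
    simpa [Fin.univ_succ] using hab
  · intro h a ha ha'
    refine h ⟨a 0, a 1, ?_, ha 0, ha 1⟩
    simpa [Fin.univ_succ] using ha'⟩

/-! ### Tests for unions, intersections, prescribed values and negation -/

section Operations

variable {K L : Set (Fn Bool Bool)} {p r : (ℕ → Bool → Bool → Bool) → Bool} [HasTest K p]

instance [HasTest L r] : HasTest (K ∪ L) fun q => p q || r q :=
  ⟨fun f => by simp [HasTest.mem_iff (K := K), HasTest.mem_iff (K := L)]⟩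

instance [HasTest L r] : HasTest (K ∩ L) fun q => p q && r q :=
  ⟨fun f => by simp [HasTest.mem_iff (K := K), HasTest.mem_iff (K := L)]⟩

instance (a : Bool) : HasTest (valZero K a) fun q => p q && botTest q == a :=
  ⟨fun f => by simp [valZero, HasTest.mem_iff (K := K), botTest_eq]⟩

instance (b : Bool) : HasTest (valOne K b) fun q => p q && topTest q == b :=
  ⟨fun f => by simp [valOne, HasTest.mem_iff (K := K), topTest_eq]⟩

instance (a b : Bool) : HasTest (val K a b) fun q =>
    (p q && botTest q == a) && (p q && topTest q == b) :=
  inferInstanceAs (HasTest (valZero K a ∩ valOne K b) _)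

instance : HasTest (eqPart K) fun q => p q && botTest q == topTest q :=
  ⟨fun f => by simp [eqPart, HasTest.mem_iff (K := K), botTest_eq, topTest_eq]⟩

instance : HasTest (neqPart K) fun q => p q && botTest q != topTest q :=
  ⟨fun f => by simp [neqPart, HasTest.mem_iff (K := K), botTest_eq, topTest_eq]⟩

instance : HasTest (leqPart K) fun q => p q && (!botTest q || topTest q) :=
  ⟨fun f => by
    simp only [leqPart, Set.mem_ofPred_eq, HasTest.mem_iff (K := K), botTest_eq, topTest_eq]
    cases f.2 ⊥ <;> cases f.2 ⊤ <;> simp⟩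

instance : HasTest (geqPart K) fun q => p q && (botTest q || !topTest q) :=
  ⟨fun f => by
    simp only [geqPart, Set.mem_ofPred_eq, HasTest.mem_iff (K := K), botTest_eq, topTest_eq]
    cases f.2 ⊥ <;> cases f.2 ⊤ <;> simp⟩

instance : HasTest (negClass K) fun q => p fun T x y => q T (!x) (!y) :=
  ⟨fun f => by
    have h : f ∈ negClass K ↔ (⟨f.1, fun a => (f.2 a)ᶜ⟩ : Fn Bool Bool) ∈ K := by
      constructor
      · rintro ⟨g, hg, rfl⟩
        simpa using hg
      · exact fun h => ⟨_, h, by simp⟩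
    rw [h, HasTest.mem_iff (K := K)]
    simp only [← bits_profile_compl]⟩

end Operations

/-- The entry at `0…0, 1…1` is a single pair, as it is for the profile of a single function. -/
def isSingle (q : ℕ → Bool → Bool → Bool) : Bool :=
  ((q 2 false false).toNat + (q 2 false true).toNat + (q 2 true false).toNat +
    (q 2 true true).toNat) == 1

theorem isSingle_profile (f : Fn Bool Bool) : isSingle (bits (profile {f})) = true := by
  have h : ∀ x y, bits (profile {f}) 2 x y = (f.2 ⊥ == x && f.2 ⊤ == y) := by
    intro x y
    rw [Bool.eq_iff_iff, bits_profile_singleton (by norm_num)]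
    simp [colsIn_two]
  simp only [isSingle, h]
  cases f.2 ⊥ <;> cases f.2 ⊤ <;> rfl

/-- The class `K` consists of the functions with profile below `m`. -/
class HasProfile (K : Set (Fn Bool Bool)) (m : outParam ℕ) : Prop where
  eq_ofProfile : K = ofProfile m

/-- Membership in `K` and in `ofProfile m` both depend only on the profile of `{f}`, one of the 93,
so it suffices to compare the two tests on the list. Entries that are not single at `0…0, 1…1`
cannot come from one function; they are skipped, since `botTest` and `topTest` mean nothing there.
-/
theorem HasProfile.of_test {K : Set (Fn Bool Bool)} {p : (ℕ → Bool → Bool → Bool) → Bool} {m : ℕ}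
    [HasTest K p] (h : (decide (m < 2 ^ 64) && stableProfiles.all fun t =>
      !isSingle (bits t) || p (bits t) == (t ||| m == m)) = true) : HasProfile K m where
  eq_ofProfile := by
    simp only [Bool.and_eq_true, decide_eq_true_eq, List.all_eq_true] at h
    ext f
    have := h.2 _ (profile_mem_stableProfiles {f})
    rw [isSingle_profile, Bool.not_true, Bool.false_or, beq_iff_eq] at this
    rw [HasTest.mem_iff (K := K), mem_ofProfile h.1, this, beq_iff_eq]

/-! ### The profiles of the 93 named classes -/

instance : HasProfile clAll 0xffffff99ffffff90 :=
  .of_test (by decide +kernel)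

/-- The explicit `K` unfolds the named class into operations on basic classes, from which instance
search assembles the test. -/
instance : HasProfile clLeq 0xffffff99fffdfb90 :=
  .of_test (K := leqPart clAll) (by decide +kernel)

instance : HasProfile clGeq 0xffffff99fffbfd90 :=
  .of_test (K := geqPart clAll) (by decide +kernel)

instance : HasProfile clNeq00 0xffffff99fff7f790 :=
  .of_test (K := neqPart clAll ∪ val clAll false false) (by decide +kernel)

instance : HasProfile clNeq11 0xffffff99fffefe90 :=
  .of_test (K := neqPart clAll ∪ val clAll true true) (by decide +kernel)

instance : HasProfile cl0XC 0xffffff99ffddbb90 :=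
  .of_test (K := valZero clAll false ∪ clC) (by decide +kernel)

instance : HasProfile clX0C 0xfffbfd99fffbfd90 :=
  .of_test (K := valOne clAll false ∪ clC) (by decide +kernel)

instance : HasProfile cl00C 0xfffbfd99ffd9b990 :=
  .of_test (K := val clAll false false ∪ clC) (by decide +kernel)

instance : HasProfile cl01C 0xfffdfb99ffddbb90 :=
  .of_test (K := val clAll false true ∪ clC) (by decide +kernel)

instance : HasProfile cl01C0 0xfffdfb99ff553310 :=
  .of_test (K := val clAll false true ∪ val clC false false) (by decide +kernel)

instance : HasProfile cl01C1 0xfffcfa98ffdcba90 :=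
  .of_test (K := val clAll false true ∪ val clC true true) (by decide +kernel)

instance : HasProfile cl1XC 0xffffff99ffbbdd90 :=
  .of_test (K := valZero clAll true ∪ clC) (by decide +kernel)

instance : HasProfile clX1C 0xfffdfb99fffdfb90 :=
  .of_test (K := valOne clAll true ∪ clC) (by decide +kernel)

instance : HasProfile cl11C 0xfffdfb99ffb9d990 :=
  .of_test (K := val clAll true true ∪ clC) (by decide +kernel)

instance : HasProfile cl10C 0xfffbfd99ffbbdd90 :=
  .of_test (K := val clAll true false ∪ clC) (by decide +kernel)

instance : HasProfile cl10C1 0xfffbfd99ffaacc80 :=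
  .of_test (K := val clAll true false ∪ val clC true true) (by decide +kernel)

instance : HasProfile cl10C0 0xfff3f591ffb3d590 :=
  .of_test (K := val clAll true false ∪ val clC false false) (by decide +kernel)

instance : HasProfile clNeq 0xffffff99fff6f690 :=
  .of_test (K := neqPart clAll) (by decide +kernel)

instance : HasProfile clEq 0xffffff99fff9f990 :=
  .of_test (K := eqPart clAll) (by decide +kernel)

instance : HasProfile cl0X 0xffffff99ff553310 :=
  .of_test (K := valZero clAll false) (by decide +kernel)

instance : HasProfile cl1X 0xffffff99ffaacc80 :=
  .of_test (K := valZero clAll true) (by decide +kernel)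

instance : HasProfile clX0 0xfff3f591fff3f590 :=
  .of_test (K := valOne clAll false) (by decide +kernel)

instance : HasProfile clX1 0xfffcfa98fffcfa90 :=
  .of_test (K := valOne clAll true) (by decide +kernel)

instance : HasProfile cl00 0xfff3f591ff513110 :=
  .of_test (K := val clAll false false) (by decide +kernel)

instance : HasProfile cl11 0xfffcfa98ffa8c880 :=
  .of_test (K := val clAll true true) (by decide +kernel)

instance : HasProfile cl01 0xfffcfa98ff543210 :=
  .of_test (K := val clAll false true) (by decide +kernel)

instance : HasProfile cl10 0xfff3f591ffa2c480 :=
  .of_test (K := val clAll true false) (by decide +kernel)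

instance : HasProfile clM 0xffddbb99ffddbb90 :=
  .of_test (by decide +kernel)

instance : HasProfile clM0 0xffddbb99ff553310 :=
  .of_test (K := valZero clM false) (by decide +kernel)

instance : HasProfile clM1 0xffdcba98ffdcba90 :=
  .of_test (K := valOne clM true) (by decide +kernel)

instance : HasProfile clMc 0xffdcba98ff543210 :=
  .of_test (K := val clM false true) (by decide +kernel)

instance : HasProfile clMneg 0xffbbdd99ffbbdd90 :=
  .of_test (K := negClass clM) (by decide +kernel)

instance : HasProfile clM0neg 0xffbbdd99ffaacc80 :=
  .of_test (K := negClass (valZero clM false)) (by decide +kernel)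

instance : HasProfile clM1neg 0xffb3d591ffb3d590 :=
  .of_test (K := negClass (valOne clM true)) (by decide +kernel)

instance : HasProfile clMcneg 0xffb3d591ffa2c480 :=
  .of_test (K := negClass (val clM false true)) (by decide +kernel)

instance : HasProfile clSmin 0xffffff99f7f7f790 :=
  .of_test (by decide +kernel)

instance : HasProfile clSminNeq 0xffffff99f7f6f690 :=
  .of_test (K := neqPart clSmin) (by decide +kernel)

instance : HasProfile clSmin0X 0xffffff99f7553310 :=
  .of_test (K := valZero clSmin false) (by decide +kernel)

instance : HasProfile clSminX0 0xfff3f591f7f3f590 :=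
  .of_test (K := valOne clSmin false) (by decide +kernel)

instance : HasProfile clSmin01C0 0xfffdfb99f7553310 :=
  .of_test (K := val clSmin false true ∪ val clC false false) (by decide +kernel)

instance : HasProfile clSmin10C0 0xfff3f591f7b3d590 :=
  .of_test (K := val clSmin true false ∪ val clC false false) (by decide +kernel)

instance : HasProfile clSmin01 0xfffcfa98f7543210 :=
  .of_test (K := val clSmin false true) (by decide +kernel)

instance : HasProfile clSmin10 0xfff3f591f7a2c480 :=
  .of_test (K := val clSmin true false) (by decide +kernel)

instance : HasProfile clSmin00 0xfff3f591f7513110 :=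
  .of_test (K := val clSmin false false) (by decide +kernel)

instance : HasProfile clSmaj 0xffffff99fefefe90 :=
  .of_test (by decide +kernel)

instance : HasProfile clSmajNeq 0xffffff99fef6f690 :=
  .of_test (K := neqPart clSmaj) (by decide +kernel)

instance : HasProfile clSmaj1X 0xffffff99feaacc80 :=
  .of_test (K := valZero clSmaj true) (by decide +kernel)

instance : HasProfile clSmajX1 0xfffcfa98fefcfa90 :=
  .of_test (K := valOne clSmaj true) (by decide +kernel)

instance : HasProfile clSmaj10C1 0xfffbfd99feaacc80 :=
  .of_test (K := val clSmaj true false ∪ val clC true true) (by decide +kernel)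

instance : HasProfile clSmaj01C1 0xfffcfa98fedcba90 :=
  .of_test (K := val clSmaj false true ∪ val clC true true) (by decide +kernel)

instance : HasProfile clSmaj10 0xfff3f591fea2c480 :=
  .of_test (K := val clSmaj true false) (by decide +kernel)

instance : HasProfile clSmaj01 0xfffcfa98fe543210 :=
  .of_test (K := val clSmaj false true) (by decide +kernel)

instance : HasProfile clSmaj11 0xfffcfa98fea8c880 :=
  .of_test (K := val clSmaj true true) (by decide +kernel)

instance : HasProfile clS 0xffffff99f6f6f690 :=
  .of_test (by decide +kernel)

instance : HasProfile clSc 0xfffcfa98f6543210 :=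
  .of_test (K := val clS false true) (by decide +kernel)

instance : HasProfile clScneg 0xfff3f591f6a2c480 :=
  .of_test (K := negClass (val clS false true)) (by decide +kernel)

instance : HasProfile clSM 0xfedcba9876543210 :=
  .of_test (K := clS ∩ clM) (by decide +kernel)

instance : HasProfile clSMneg 0xf7b3d591e6a2c480 :=
  .of_test (K := negClass (clS ∩ clM)) (by decide +kernel)

instance : HasProfile clU 0xffffff9977553310 :=
  .of_test (by decide +kernel)

instance : HasProfile clTcUC0 0xfffdfb9977553310 :=
  .of_test (K := val clU false true ∪ val clC false false) (by decide +kernel)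

instance : HasProfile clTcU 0xfffcfa9877543210 :=
  .of_test (K := val clU false true) (by decide +kernel)

instance : HasProfile clMU 0xffddbb9977553310 :=
  .of_test (K := clM ∩ clU) (by decide +kernel)

instance : HasProfile clMcU 0xffdcba9877543210 :=
  .of_test (K := val clM false true ∩ clU) (by decide +kernel)

instance : HasProfile clU00 0xfff3f59177513110 :=
  .of_test (K := val clU false false) (by decide +kernel)

instance : HasProfile clUneg 0xffffff99eeaacc80 :=
  .of_test (K := negClass clU) (by decide +kernel)

instance : HasProfile clTcUnegC1 0xfffbfd99eeaacc80 :=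
  .of_test (K := negClass (val clU false true) ∪ val clC true true) (by decide +kernel)

instance : HasProfile clTcUneg 0xfff3f591eea2c480 :=
  .of_test (K := negClass (val clU false true)) (by decide +kernel)

instance : HasProfile clMUneg 0xffbbdd99eeaacc80 :=
  .of_test (K := negClass (clM ∩ clU)) (by decide +kernel)

instance : HasProfile clMcUneg 0xffb3d591eea2c480 :=
  .of_test (K := negClass (val clM false true ∩ clU)) (by decide +kernel)

instance : HasProfile clUneg11 0xfffcfa98eea8c880 :=
  .of_test (K := val (negClass clU) true true) (by decide +kernel)

instance : HasProfile clW 0xfefcfa98fefcfa90 :=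
  .of_test (by decide +kernel)

instance : HasProfile clTcWC1 0xfefcfa98fedcba90 :=
  .of_test (K := val clW false true ∪ val clC true true) (by decide +kernel)

instance : HasProfile clTcW 0xfefcfa98fe543210 :=
  .of_test (K := val clW false true) (by decide +kernel)

instance : HasProfile clMW 0xfedcba98fedcba90 :=
  .of_test (K := clM ∩ clW) (by decide +kernel)

instance : HasProfile clMcW 0xfedcba98fe543210 :=
  .of_test (K := val clM false true ∩ clW) (by decide +kernel)

instance : HasProfile clW11 0xfefcfa98fea8c880 :=
  .of_test (K := val clW true true) (by decide +kernel)

instance : HasProfile clWneg 0xf7f3f591f7f3f590 :=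
  .of_test (K := negClass clW) (by decide +kernel)

instance : HasProfile clTcWnegC0 0xf7f3f591f7b3d590 :=
  .of_test (K := negClass (val clW false true) ∪ val clC false false) (by decide +kernel)

instance : HasProfile clTcWneg 0xf7f3f591f7a2c480 :=
  .of_test (K := negClass (val clW false true)) (by decide +kernel)

instance : HasProfile clMWneg 0xf7b3d591f7b3d590 :=
  .of_test (K := negClass (clM ∩ clW)) (by decide +kernel)

instance : HasProfile clMcWneg 0xf7b3d591f7a2c480 :=
  .of_test (K := negClass (val clM false true ∩ clW)) (by decide +kernel)

instance : HasProfile clWneg00 0xf7f3f591f7513110 :=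
  .of_test (K := val (negClass clW) false false) (by decide +kernel)

instance : HasProfile clUWneg 0xf7f3f59177513110 :=
  .of_test (K := clU ∩ negClass clW) (by decide +kernel)

instance : HasProfile clWUneg 0xfefcfa98eea8c880 :=
  .of_test (K := clW ∩ negClass clU) (by decide +kernel)

instance : HasProfile clR 0xffffff99f9f9f990 :=
  .of_test (by decide +kernel)

instance : HasProfile clR00C 0xfffbfd99f9d9b990 :=
  .of_test (K := val clR false false ∪ clC) (by decide +kernel)

instance : HasProfile clR11C 0xfffdfb99f9b9d990 :=
  .of_test (K := val clR true true ∪ clC) (by decide +kernel)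

instance : HasProfile clR00 0xfff3f591f9513110 :=
  .of_test (K := val clR false false) (by decide +kernel)

instance : HasProfile clR11 0xfffcfa98f9a8c880 :=
  .of_test (K := val clR true true) (by decide +kernel)

instance : HasProfile clC 0x9999999999999990 :=
  .of_test (by decide +kernel)

instance : HasProfile clC0 0x1111111111111110 :=
  .of_test (K := val clC false false) (by decide +kernel)

instance : HasProfile clC1 0x8888888888888880 :=
  .of_test (K := val clC true true) (by decide +kernel)

instance : HasProfile (∅ : Set (Fn Bool Bool)) 0x0 :=
  .of_test (by decide +kernel)

/-! Enumerations of stable classes. -/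

/-- The members of `S` are the classes with profiles in `l`. -/
class Enumerates (S : Set (Set (Fn Bool Bool))) (l : outParam (List ℕ)) : Prop where
  eq_image : S = ofProfile '' {m | m ∈ l}

instance {K : Set (Fn Bool Bool)} {m : ℕ} [h : HasProfile K m] : Enumerates {K} [m] :=
  ⟨by simp [h.eq_ofProfile]⟩

/-- Instance search descends through an explicit set of named classes and computes the list of their
profiles. -/
instance {K : Set (Fn Bool Bool)} {S : Set (Set (Fn Bool Bool))} {m : ℕ} {l : List ℕ}
    [h : HasProfile K m] [hS : Enumerates S l] : Enumerates (insert K S) (m :: l) :=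
  ⟨by
    rw [hS.eq_image, h.eq_ofProfile, ← Set.image_insert_eq]
    congr 1
    ext
    simp⟩

/-! ### Stability and clones on the level of profiles -/

theorem clIc_subset_clSM : clIc ⊆ clSM := by
  rintro f ⟨i, hi⟩
  exact ⟨fun a => by simp [hi], fun a b hab => by simpa only [hi] using hab i⟩

theorem comp_mono {A B C : Type*} {I I' : Set (Fn B C)} {J J' : Set (Fn A B)} (hI : I ⊆ I')
    (hJ : J ⊆ J') : comp I J ⊆ comp I' J' := by
  rintro _ ⟨n, m, f, g, hf, hg, rfl⟩
  exact ⟨n, m, f, g, hI hf, fun i => hJ (hg i), rfl⟩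

theorem IsStable.mono {A B : Type*} {C₁ D₁ : Set (Fn A A)} {C₂ D₂ : Set (Fn B B)}
    {F : Set (Fn A B)} (h : IsStable D₁ D₂ F) (h₁ : C₁ ⊆ D₁) (h₂ : C₂ ⊆ D₂) : IsStable C₁ C₂ F :=
  ⟨(comp_mono subset_rfl h₁).trans h.1, (comp_mono h₂ subset_rfl).trans h.2⟩

theorem IsStable.exists_profile {F : Set (Fn Bool Bool)} (h : IsStable clIc clSM F) :
    ∃ m ∈ stableProfiles, F = ofProfile m :=
  ⟨_, profile_mem_stableProfiles F, eq_ofProfile_profile h⟩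

theorem isStable_ofProfile_iff {c m : ℕ} (hc : c ∈ stableProfiles) (hm : m ∈ stableProfiles) :
    IsStable (ofProfile c) (ofProfile c) (ofProfile m) ↔ (compLe m c m && compLe c m m) = true := by
  rw [IsStable, comp_ofProfile_subset_iff hm hc, comp_ofProfile_subset_iff hc hm, Bool.and_eq_true]

/-- `l` consists of the profiles of the classes that are stable under the clone with profile `c`. -/
def enumeratesStable (c : ℕ) (l : List ℕ) : Bool :=
  stableProfiles.contains c && (l.all stableProfiles.contains &&
    stableProfiles.all fun m => (compLe m c m && compLe c m m) == l.contains m)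

/-- As `S ∩ M ⊆ C`, a `C`-stable class is `(I_c, S ∩ M)`-stable, hence one of the 93; which of them
are `C`-stable is computed. -/
theorem stableClasses_eq {C : Set (Fn Bool Bool)} {S : Set (Set (Fn Bool Bool))} {c : ℕ}
    {l : List ℕ} [hC : HasProfile C c] [hS : Enumerates S l] (hSM : clSM ⊆ C)
    (h : enumeratesStable c l = true) : stableClasses C C = S := by
  simp only [enumeratesStable, Bool.and_eq_true, List.all_eq_true, List.contains_iff_mem,
    beq_iff_eq] at h
  obtain ⟨hc, hl, h⟩ := h
  rw [hS.eq_image]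
  ext F
  constructor
  · intro hF
    obtain ⟨m, hm, rfl⟩ := (IsStable.mono hF (clIc_subset_clSM.trans hSM) hSM).exists_profile
    refine ⟨m, ?_, rfl⟩
    rw [stableClasses, Set.mem_ofPred_eq, hC.eq_ofProfile, isStable_ofProfile_iff hc hm, h m hm,
      List.contains_iff_mem] at hF
    exact hF
  · rintro ⟨m, hm, rfl⟩
    rw [stableClasses, Set.mem_ofPred_eq, hC.eq_ofProfile, isStable_ofProfile_iff hc (hl m hm),
      h m (hl m hm), List.contains_iff_mem]
    exact hm

theorem clSM_subset {C : Set (Fn Bool Bool)} {s c : ℕ} [hs : HasProfile clSM s]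
    [hC : HasProfile C c] (h : s ||| c = c) : clSM ⊆ C := by
  rw [hC.eq_ofProfile, hs.eq_ofProfile]
  exact ofProfile_mono h

/-- The projections lie in `S ∩ M`, so for a class above `S ∩ M` only closure under composition has
to be tested. -/
theorem clones_eq {S : Set (Set (Fn Bool Bool))} {l : List ℕ} {s : ℕ} [hs : HasProfile clSM s]
    [hS : Enumerates S l] (hsl : (stableProfiles.contains s && (l.all stableProfiles.contains &&
      stableProfiles.all fun m => (compLe m m m && (s ||| m == m)) == l.contains m)) = true) :
    {C | IsClone C ∧ clSM ⊆ C} = S := by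
  simp only [Bool.and_eq_true, List.all_eq_true, List.contains_iff_mem, beq_iff_eq] at hsl
  obtain ⟨hsm, hl, h⟩ := hsl
  have key : ∀ m ∈ stableProfiles,
      (IsClone (ofProfile m) ∧ clSM ⊆ ofProfile m ↔ m ∈ l) := by
    intro m hm
    rw [← List.contains_iff_mem, ← h m hm, Bool.and_eq_true, beq_iff_eq,
      ← comp_ofProfile_subset_iff hm hm]
    constructor
    · refine fun h => ⟨h.1.2, ?_⟩
      have := profile_mono h.2
      rwa [hs.eq_ofProfile, profile_ofProfile hsm, profile_ofProfile hm] at this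
    · intro h
      have hSM : clSM ⊆ ofProfile m := hs.eq_ofProfile ▸ ofProfile_mono h.2
      exact ⟨⟨clIc_subset_clSM.trans hSM, h.1⟩, hSM⟩
  rw [hS.eq_image]
  ext C
  constructor
  · intro hC
    have hstable : IsStable C C C := ⟨hC.1.2, hC.1.2⟩
    obtain ⟨m, hm, rfl⟩ :=
      (hstable.mono (clIc_subset_clSM.trans hC.2) hC.2).exists_profile
    exact ⟨m, (key m hm).1 hC, rfl⟩
  · rintro ⟨m, hm, rfl⟩
    exact (key m (hl m hm)).2 hm

/-- All 93 classes are stable even under `S ∩ M` on both sides, which also shows that the two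
notions of stability in (a) agree. -/
theorem stableClasses_clIc_clSM :
    stableClasses clIc clSM = ofProfile '' {m | m ∈ stableProfiles} := by
  have hc : 0xfedcba9876543210 ∈ stableProfiles := by decide +kernel
  have h : ∀ m ∈ stableProfiles,
      (compLe m 0xfedcba9876543210 m && compLe 0xfedcba9876543210 m m) = true := by
    decide +kernel
  ext F
  constructor
  · intro hF
    obtain ⟨m, hm, rfl⟩ := hF.exists_profile
    exact ⟨m, hm, rfl⟩
  · rintro ⟨m, hm, rfl⟩
    have hstable := (isStable_ofProfile_iff hc hm).2 (h m hm)
    rw [← HasProfile.eq_ofProfile (K := clSM)] at hstable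
    exact hstable.mono clIc_subset_clSM subset_rfl

theorem stableClasses_clSM : stableClasses clSM clSM = stableClasses clIc clSM := by
  rw [stableClasses_clIc_clSM]
  have : Enumerates (ofProfile '' {m | m ∈ stableProfiles}) stableProfiles := ⟨rfl⟩
  exact stableClasses_eq subset_rfl (by decide +kernel)

theorem ncard_stableClasses : (stableClasses clIc clSM).ncard = 93 := by
  have h : stableProfiles.Nodup := by decide +kernel
  have : {m | m ∈ stableProfiles} = (stableProfiles.toFinset : Set ℕ) := by ext; simp
  rw [stableClasses_clIc_clSM, ofProfile_injOn.ncard_image, this,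
    Set.ncard_coe_finset, List.toFinset_card_of_nodup h]
  rfl

end BoolClass

set_option synthInstance.maxSize 10000 in
set_option synthInstance.maxHeartbeats 400000 in
theorem mainTheorem4 :
    ({C | IsClone C ∧ clSM ⊆ C} : Set (Set (Fn Bool Bool))) =
      {clSM, clMcU, clMU, clTcU, clU, clMcW, clMW, clTcW, clW, clSc, clS, clMc, clM0, clM1, clM,
       cl01, cl0X, clX1, clAll} ∧
    stableClasses clSM clSM = stableClasses clIc clSM ∧
    (stableClasses clIc clSM).ncard = 93 ∧
    stableClasses clSM clSM =
      {clAll, clLeq, clGeq, clNeq00, clNeq11, cl0XC, clX0C, cl00C, cl01C, cl01C0, cl01C1, cl1XC,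
       clX1C, cl11C, cl10C, cl10C1, cl10C0, clNeq, clEq, cl0X, cl1X, clX0, clX1, cl00, cl11,
       cl01, cl10, clM, clM0, clM1, clMc, clMneg, clM0neg, clM1neg, clMcneg, clSmin, clSminNeq,
       clSmin0X, clSminX0, clSmin01C0, clSmin10C0, clSmin01, clSmin10, clSmin00, clSmaj,
       clSmajNeq, clSmaj1X, clSmajX1, clSmaj10C1, clSmaj01C1, clSmaj10, clSmaj01, clSmaj11,
       clS, clSc, clScneg, clSM, clSMneg, clU, clTcUC0, clTcU, clMU, clMcU, clU00, clUneg,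
       clTcUnegC1, clTcUneg, clMUneg, clMcUneg, clUneg11, clW, clTcWC1, clTcW, clMW, clMcW,
       clW11, clWneg, clTcWnegC0, clTcWneg, clMWneg, clMcWneg, clWneg00, clUWneg, clWUneg, clR,
       clR00C, clR11C, clR00, clR11, clC, clC0, clC1, ∅} ∧
    stableClasses clMcU clMcU =
      {clAll, clLeq, clGeq, clNeq00, clEq, cl0XC, cl1XC, clX0C, clX1C, cl0X, cl1X, clX0, clX1,
       cl00C, cl11C, cl00, cl11, cl01C, cl10C, cl01C0, cl10C1, cl01C1, cl10C0, cl01, cl10, clM,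
       clMneg, clM0, clM0neg, clM1, clM1neg, clMc, clMcneg, clU, clTcUC0, clTcU, clMU, clMcU,
       clU00, clC, clC0, clC1, ∅} ∧
    stableClasses clMU clMU =
      {clAll, cl0XC, cl1XC, cl0X, clM, clMneg, clM0, clU, clMU, clC, clC0, ∅} ∧
    stableClasses clTcU clTcU =
      {clAll, clNeq00, clEq, cl0X, cl1X, clX0, clX1, cl00, cl11, cl01, cl10, clU, clTcU, clU00,
       clC, clC0, clC1, ∅} ∧
    stableClasses clU clU =
      {clAll, cl0X, clU, clC, clC0, ∅} ∧
    stableClasses clMcW clMcW =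
      {clAll, clLeq, clGeq, clNeq11, clEq, cl0XC, cl1XC, clX0C, clX1C, cl0X, cl1X, clX0, clX1,
       cl00C, cl11C, cl00, cl11, cl01C, cl10C, cl01C0, cl10C1, cl01C1, cl10C0, cl01, cl10, clM,
       clMneg, clM0, clM0neg, clM1, clM1neg, clMc, clMcneg, clW, clTcWC1, clTcW, clMW, clMcW,
       clW11, clC, clC0, clC1, ∅} ∧
    stableClasses clMW clMW =
      {clAll, clX0C, clX1C, clX1, clM, clMneg, clM1, clW, clMW, clC, clC1, ∅} ∧
    stableClasses clTcW clTcW =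
      {clAll, clNeq11, clEq, cl0X, cl1X, clX0, clX1, cl00, cl11, cl01, cl10, clW, clTcW, clW11,
       clC, clC0, clC1, ∅} ∧
    stableClasses clW clW =
      {clAll, clX1, clW, clC, clC1, ∅} ∧
    stableClasses clSc clSc =
      {clAll, clEq, clNeq, cl0X, cl1X, clX0, clX1, cl00, cl11, cl01, cl10, clS, clSc, clScneg,
       clR, clR00, clR11, clC, clC0, clC1, ∅} ∧
    stableClasses clS clS =
      {clAll, clS, clR, clC, ∅} ∧
    stableClasses clMc clMc =
      {clAll, clGeq, clLeq, clEq, cl0XC, cl1XC, clX0C, clX1C, cl0X, cl1X, clX0, clX1, cl00C,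
       cl11C, cl00, cl11, cl01C, cl10C, cl01C0, cl10C1, cl01C1, cl10C0, cl01, cl10, clM,
       clMneg, clM0, clM0neg, clM1, clM1neg, clMc, clMcneg, clC, clC0, clC1, ∅} ∧
    stableClasses clM0 clM0 =
      {clAll, cl0XC, cl1XC, cl0X, clM, clMneg, clM0, clC, clC0, ∅} ∧
    stableClasses clM1 clM1 =
      {clAll, clX0C, clX1C, clX1, clM, clMneg, clM1, clC, clC1, ∅} ∧
    stableClasses clM clM =
      {clAll, clM, clMneg, clC, ∅} ∧
    stableClasses cl01 cl01 =
      {clAll, clEq, cl0X, cl1X, clX0, clX1, cl00, cl11, cl01, cl10, clC, clC0, clC1, ∅} ∧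
    stableClasses cl0X cl0X =
      {clAll, cl0X, clC, clC0, ∅} ∧
    stableClasses clX1 clX1 =
      {clAll, clX1, clC, clC1, ∅} ∧
    stableClasses clAll clAll =
      {clAll, clC, ∅} := by
  refine ⟨clones_eq (by decide +kernel), stableClasses_clSM, ncard_stableClasses,
    stableClasses_eq subset_rfl (by decide +kernel), ?_⟩
  refine ⟨?_, ?_, ?_, ?_, ?_, ?_, ?_, ?_, ?_, ?_, ?_, ?_, ?_, ?_, ?_, ?_, ?_, ?_⟩ <;>
    exact stableClasses_eq (clSM_subset (by decide +kernel)) (by decide +kernel)
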